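/- Let $F$ be a Fréchet space and $M$ a smooth manifold modelled on $F$, smoothness being understood in the sense of Michal–Bastiani. Let $\Pi_M:TM\to M$ and $\Pi_{TM}:T(TM)\to TM$ be the projections, let $\mathrm{Inv}:T(TM)\to T(TM)$, locally $(x,v,u,w)\mapsto(x,u,v,w)$, be the canonical involution, and let $T^2M=\{\xi\in T(TM):\Pi_{TM}(\xi)=T\Pi_M(\xi)\}$ be the second-order tangent bundle (locally its elements are $(x,v,v,w)$), which is a smooth manifold over $M$. Let $S:TM\to T(TM)$ be a smooth spray on $M$, i.e. $\Pi_{TM}\circ S=T\Pi_M\circ S=\mathrm{id}$ and $S(sv)=(L_s)_*(sS(v))$ for $s\in\mathbb R$, where $L_s$ is multiplication by $s$ on $TM$. Locally $S(x,v)=(x,v,v,S_2(x,v))$; let $B(x;\cdot,\cdot)=\tfrac12D_2^2S_2(x,0)$ be the associated symmetric bilinear map, and let $K:T(TM)\to TM$, $K(x,v,u,w)=(x,\,w-B(x;v,u))$, be the associated connection map. Give the fibres of $T^2M\to M$ the vector space structure that makes $(\Pi_{TM},K):T^2M\to TM\oplus TM$ linear on fibres. Write $\mathrm{pr}_1=\Pi_{TM}|_{T^2M}$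 and $\mathrm{pr}_2=K|_{T^2M}$ for the two projections $T^2M\to TM$ and $\iota_1,\iota_2:TM\to T^2M$ for the two corresponding inclusions of summands. For a smooth vector bundle $\Pi:V\to M$, a linear connection is a smooth map $C:TV\to TV$ which maps each $T_pV$ linearly into the vertical space $\ker T_p\Pi$, is the identity on vertical vectors, and is linear on the fibres of $T\Pi:TV\to TM$. Vertical vectors of $V$ are compared through the map that sends $\frac{d}{dt}\big|_{t=0}(p+tq)$ to $q$. A linear connection $C$ on $TM$ is symmetric if $C\circ\mathrm{Inv}=C$, and a linear connection $\mathcal C$ on $T^2M$ is symmetric if $\mathcal C\circ T\iota_i\circ\mathrm{Inv}=\mathcal C\circ T\iota_i$ for $i=1,2$; both equalities mean that the two vertical vectors correspond to the same $q$. Theorem. (0) With the structure induced by $S$, $T^2M$ is a smooth vector bundle over $M$ with typical fibre $F\times F$. (1) Every linear symmetric connection $C$ on $TM$ induces a linear symmetric connection on $T^2M$: there is exactly one linear symmetric connection $\mathcal C$ on $T^2M$ with $T\mathrm{pr}_i\circ\mathcal C=C\circ T\mathrm{pr}_i$ for $i=1,2$. (2) Conversely, every linear connection $\mathcal C$ on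 $T^2M$ induces linear connections on $TM$: for $i=1,2$ the map $T\mathrm{pr}_i\circ\mathcal C\circ T\iota_i$ is a linear connection on $TM$, and it is symmetric if $\mathcal C$ is symmetric. -/

import Mathlib

universe u v w

set_option linter.unusedSectionVars false

open Set Filter Topology

namespace FrechetGeometry

noncomputable section

/-! ### Michal--Bastiani calculus in locally convex spaces -/

section Calculus

/-- `y` is the derivative of `f` at `x` in the direction `h`:
`y = lim_{t → 0} (1 / t) (f (x + t h) - f x)`. -/
def HasDirDeriv {E : Type*} {G : Type*} [AddCommGroup E] [Module ℝ E]
    [AddCommGroup G] [Module ℝ G] [TopologicalSpace G] (f : E → G) (x h : E) (y : G) : Prop :=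
  Tendsto (fun t : ℝ => t⁻¹ • (f (x + t • h) - f x)) (𝓝[≠] 0) (𝓝 y)

/-- The directional derivative `D f (x) (h)` (used only where the limit exists). -/
def dirDeriv {E : Type*} {G : Type*} [AddCommGroup E] [Module ℝ E]
    [AddCommGroup G] [Module ℝ G] [TopologicalSpace G] (f : E → G) (x h : E) : G :=
  limUnder (𝓝[≠] (0 : ℝ)) (fun t : ℝ => t⁻¹ • (f (x + t • h) - f x))

/-- `f` is of class `C^n` on the open set `U` in the sense of Michal--Bastiani (Keller's `C_c^n`):
`f` is continuous on `U` and, for `n ≥ 1`, all directional derivatives of `f` exist on `U` and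
`(x, h) ↦ D f (x) (h)` is of class `C^(n-1)` on `U × E`. -/
def ContDiffMB {G : Type w} [AddCommGroup G] [Module ℝ G] [TopologicalSpace G] :
    (n : ℕ) → {E : Type u} → [AddCommGroup E] → [Module ℝ E] → [TopologicalSpace E] →
      (f : E → G) → (U : Set E) → Prop
  | 0, _, _, _, _, f, U => ContinuousOn f U
  | n + 1, E, _, _, _, f, U =>
      ContinuousOn f U ∧ (∀ x ∈ U, ∀ h, ∃ y, HasDirDeriv f x h y) ∧
        ContDiffMB n (fun p : E × E => dirDeriv f p.1 p.2) (U ×ˢ univ)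

/-- Smooth (`C^∞`) maps on an open set. -/
def SmoothMB {E : Type u} {G : Type w} [AddCommGroup E] [Module ℝ E] [TopologicalSpace E]
    [AddCommGroup G] [Module ℝ G] [TopologicalSpace G] (f : E → G) (U : Set E) : Prop :=
  ∀ n, ContDiffMB n f U

variable {E : Type u} [AddCommGroup E] [Module ℝ E] [TopologicalSpace E]
  {G : Type w} [AddCommGroup G] [Module ℝ G] [TopologicalSpace G]
  {G' : Type*} [AddCommGroup G'] [Module ℝ G'] [TopologicalSpace G']

theorem HasDirDeriv.eq [T2Space G] {f : E → G} {x h : E} {y : G} (H : HasDirDeriv f x h y) :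
    dirDeriv f x h = y :=
  Tendsto.limUnder_eq H

theorem hasDirDeriv_dirDeriv [T2Space G] {f : E → G} {x h : E}
    (H : ∃ y, HasDirDeriv f x h y) : HasDirDeriv f x h (dirDeriv f x h) := by
  obtain ⟨y, hy⟩ := H
  rwa [hy.eq]

theorem ContDiffMB.continuousOn {n : ℕ} {f : E → G} {U : Set E} (H : ContDiffMB n f U) :
    ContinuousOn f U := by
  cases n with
  | zero => exact H
  | succ n => exact H.1

theorem SmoothMB.continuousOn {f : E → G} {U : Set E} (H : SmoothMB f U) : ContinuousOn f U := H 0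

theorem SmoothMB.hasDirDeriv [T2Space G] {f : E → G} {U : Set E} (H : SmoothMB f U) {x : E}
    (hx : x ∈ U) (h : E) : HasDirDeriv f x h (dirDeriv f x h) :=
  hasDirDeriv_dirDeriv ((H 1).2.1 x hx h)

theorem SmoothMB.dirDeriv {f : E → G} {U : Set E} (H : SmoothMB f U) :
    SmoothMB (fun p : E × E => dirDeriv f p.1 p.2) (U ×ˢ univ) :=
  fun n => (H (n + 1)).2.2

theorem line_tendsto [ContinuousAdd E] [ContinuousSMul ℝ E] (x h : E) :
    Tendsto (fun t : ℝ => x + t • h) (𝓝[≠] 0) (𝓝 x) := by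
  have : Continuous (fun t : ℝ => x + t • h) := by fun_prop
  have h2 := this.tendsto 0
  simp only [zero_smul, add_zero] at h2
  exact h2.mono_left nhdsWithin_le_nhds

theorem HasDirDeriv.congr [ContinuousAdd E] [ContinuousSMul ℝ E] {f g : E → G} {U : Set E}
    (hU : IsOpen U) (hfg : EqOn f g U) {x : E} (hx : x ∈ U) {h : E} {y : G}
    (H : HasDirDeriv f x h y) : HasDirDeriv g x h y := by
  refine Tendsto.congr' ?_ H
  filter_upwards [(line_tendsto x h).eventually (hU.mem_nhds hx)] with t ht
  rw [hfg ht, hfg hx]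

theorem dirDeriv_congr [ContinuousAdd E] [ContinuousSMul ℝ E] {f g : E → G} {U : Set E}
    (hU : IsOpen U) (hfg : EqOn f g U) {x : E} (hx : x ∈ U) (h : E) :
    dirDeriv f x h = dirDeriv g x h := by
  unfold FrechetGeometry.dirDeriv limUnder
  congr 1
  refine Filter.map_congr ?_
  filter_upwards [(line_tendsto x h).eventually (hU.mem_nhds hx)] with t ht
  rw [hfg ht, hfg hx]

theorem ContDiffMB.congr {n : ℕ} : ∀ {E : Type u} [AddCommGroup E] [Module ℝ E]
    [TopologicalSpace E] [ContinuousAdd E] [ContinuousSMul ℝ E] {f g : E → G} {U : Set E},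
    IsOpen U → EqOn f g U → ContDiffMB n f U → ContDiffMB n g U := by
  induction n with
  | zero => intro E _ _ _ _ _ f g U hU hfg H; exact ContinuousOn.congr H (fun x hx => (hfg hx).symm)
  | succ n ih =>
    intro E _ _ _ _ _ f g U hU hfg H
    refine ⟨ContinuousOn.congr H.1 (fun x hx => (hfg hx).symm), fun x hx h => ?_, ?_⟩
    · obtain ⟨y, hy⟩ := H.2.1 x hx h
      exact ⟨y, hy.congr hU hfg hx⟩
    · exact ih (hU.prod isOpen_univ) (fun p hp => dirDeriv_congr hU hfg hp.1 p.2) H.2.2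

theorem ContDiffMB.mono {n : ℕ} : ∀ {E : Type u} [AddCommGroup E] [Module ℝ E]
    [TopologicalSpace E] {f : E → G} {U V : Set E},
    V ⊆ U → ContDiffMB n f U → ContDiffMB n f V := by
  induction n with
  | zero => intro E _ _ _ f U V h H; exact ContinuousOn.mono H h
  | succ n ih =>
    intro E _ _ _ f U V h H
    exact ⟨H.1.mono h, fun x hx => H.2.1 x (h hx), ih (prod_mono h subset_rfl) H.2.2⟩

theorem ContDiffMB.comp_clm {n : ℕ} : ∀ {E E' : Type u} [AddCommGroup E] [Module ℝ E]
    [TopologicalSpace E] [AddCommGroup E'] [Module ℝ E'] [TopologicalSpace E']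
    {f : E → G} {U : Set E} (A : E' →L[ℝ] E) {V : Set E'},
    MapsTo A V U → ContDiffMB n f U → ContDiffMB n (fun x => f (A x)) V := by
  induction n with
  | zero =>
    intro E E' _ _ _ _ _ _ f U A V hA H
    exact ContinuousOn.comp H A.continuous.continuousOn hA
  | succ n ih =>
    intro E E' _ _ _ _ _ _ f U A V hA H
    refine ⟨ContinuousOn.comp H.1 A.continuous.continuousOn hA, fun x hx h => ?_, ?_⟩
    · obtain ⟨y, hy⟩ := H.2.1 (A x) (hA hx) (A h)
      refine ⟨y, ?_⟩
      simpa [HasDirDeriv] using hy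
    · have := ih (A.prodMap A) (V := V ×ˢ univ) (U := U ×ˢ univ)
        (fun p hp => ⟨hA hp.1, mem_univ _⟩) H.2.2
      simpa [FrechetGeometry.dirDeriv] using this

theorem HasDirDeriv.clm_comp {f : E → G} {x h : E} {y : G} (L : G →L[ℝ] G')
    (H : HasDirDeriv f x h y) : HasDirDeriv (fun x => L (f x)) x h (L y) := by
  have := (L.continuous.tendsto y).comp H
  refine this.congr fun t => ?_
  simp

theorem ContDiffMB.clm_comp [T2Space G] [T2Space G'] (L : G →L[ℝ] G') {n : ℕ} :
    ∀ {E : Type u} [AddCommGroup E] [Module ℝ E] [TopologicalSpace E] [ContinuousAdd E]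
      [ContinuousSMul ℝ E] {f : E → G} {U : Set E},
    IsOpen U → ContDiffMB n f U → ContDiffMB n (fun x => L (f x)) U := by
  induction n with
  | zero => intro E _ _ _ _ _ f U _ H; exact L.continuous.comp_continuousOn H
  | succ n ih =>
    intro E _ _ _ _ _ f U hU H
    refine ⟨L.continuous.comp_continuousOn H.1, fun x hx h => ?_, ?_⟩
    · obtain ⟨y, hy⟩ := H.2.1 x hx h
      exact ⟨L y, hy.clm_comp L⟩
    · refine (ih (hU.prod isOpen_univ) H.2.2).congr (hU.prod isOpen_univ) fun p hp => ?_
      exact ((hasDirDeriv_dirDeriv (H.2.1 p.1 hp.1 p.2)).clm_comp L).eq.symm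

theorem HasDirDeriv.prodMk {f : E → G} {g : E → G'} {x h : E} {y : G} {z : G'}
    (hf : HasDirDeriv f x h y) (hg : HasDirDeriv g x h z) :
    HasDirDeriv (fun x => (f x, g x)) x h (y, z) := by
  refine (hf.prodMk_nhds hg).congr fun t => ?_
  simp

theorem ContDiffMB.prodMk [T2Space G] [T2Space G'] {n : ℕ} :
    ∀ {E : Type u} [AddCommGroup E] [Module ℝ E] [TopologicalSpace E] [ContinuousAdd E]
      [ContinuousSMul ℝ E] {f : E → G} {g : E → G'} {U : Set E},
    IsOpen U → ContDiffMB n f U → ContDiffMB n g U → ContDiffMB n (fun x => (f x, g x)) U := by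
  induction n with
  | zero => intro E _ _ _ _ _ f g U _ H H'; exact ContinuousOn.prodMk H H'
  | succ n ih =>
    intro E _ _ _ _ _ f g U hU H H'
    refine ⟨H.1.prodMk H'.1, fun x hx h => ?_, ?_⟩
    · obtain ⟨y, hy⟩ := H.2.1 x hx h
      obtain ⟨z, hz⟩ := H'.2.1 x hx h
      exact ⟨_, hy.prodMk hz⟩
    · refine (ih (hU.prod isOpen_univ) H.2.2 H'.2.2).congr (hU.prod isOpen_univ) fun p hp => ?_
      exact ((hasDirDeriv_dirDeriv (H.2.1 p.1 hp.1 p.2)).prodMk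
        (hasDirDeriv_dirDeriv (H'.2.1 p.1 hp.1 p.2))).eq.symm

theorem hasDirDeriv_id [ContinuousAdd E] [ContinuousSMul ℝ E] (x h : E) :
    HasDirDeriv (fun x : E => x) x h h := by
  refine tendsto_const_nhds.congr' ?_
  filter_upwards [self_mem_nhdsWithin] with t ht
  simp [inv_smul_smul₀ (show t ≠ 0 from ht)]

section Chain

variable [IsTopologicalAddGroup E] [ContinuousSMul ℝ E]
  [IsTopologicalAddGroup G] [ContinuousSMul ℝ G] [LocallyConvexSpace ℝ G] [T2Space G]

/-- Mean value estimate along a segment. -/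
theorem slope_mem {f : E → G} {x k : E} {t : ℝ} (ht : t ≠ 0) {C : Set G} (hC : Convex ℝ C)
    (hCc : IsClosed C)
    (H : ∀ s ∈ uIcc 0 t, ∃ y ∈ C, HasDirDeriv f (x + s • k) k y) :
    t⁻¹ • (f (x + t • k) - f x) ∈ C := by
  by_contra hcon
  obtain ⟨ℓ, c, hlt, hgt⟩ := geometric_hahn_banach_closed_point hC hCc hcon
  choose! y hyC hy using H
  have hder : ∀ s ∈ uIcc 0 t, HasDerivAt (fun s : ℝ => ℓ (f (x + s • k))) (ℓ (y s)) s := by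
    intro s hs
    rw [hasDerivAt_iff_tendsto_slope_zero]
    refine Tendsto.congr (fun r => ?_) ((hy s hs).clm_comp ℓ)
    simp [add_smul, add_assoc]
  have key : ∃ s ∈ uIcc 0 t, ℓ (t⁻¹ • (f (x + t • k) - f x)) = ℓ (y s) := by
    rcases lt_or_gt_of_ne ht with h | h
    · rw [uIcc_of_ge h.le] at hder ⊢
      obtain ⟨s, hs, hs'⟩ := exists_hasDerivAt_eq_slope _ _ h
        (fun s hs => (hder s hs).continuousAt.continuousWithinAt)
        (fun s hs => hder s (Ioo_subset_Icc_self hs))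
      refine ⟨s, Ioo_subset_Icc_self hs, ?_⟩
      simp only [hs', map_smul, map_sub, smul_eq_mul, zero_smul, add_zero]
      field_simp
      ring
    · rw [uIcc_of_le h.le] at hder ⊢
      obtain ⟨s, hs, hs'⟩ := exists_hasDerivAt_eq_slope _ _ h
        (fun s hs => (hder s hs).continuousAt.continuousWithinAt)
        (fun s hs => hder s (Ioo_subset_Icc_self hs))
      refine ⟨s, Ioo_subset_Icc_self hs, ?_⟩
      simp only [hs', map_smul, map_sub, smul_eq_mul, zero_smul, add_zero]
      field_simp
      ring
  obtain ⟨s, hs, hs'⟩ := key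
  rw [hs'] at hgt
  exact absurd (hlt _ (hyC s hs)) (not_lt.2 hgt.le)

/-- For a `C^1` map, difference quotients converge jointly in the direction. -/
theorem tendsto_slope {f : E → G} {U : Set E} (hU : IsOpen U)
    (hf : ContDiffMB 1 f U) {x : E} (hx : x ∈ U) (h : E) :
    Tendsto (fun p : ℝ × E => p.1⁻¹ • (f (x + p.1 • p.2) - f x)) (𝓝[≠] 0 ×ˢ 𝓝 h)
      (𝓝 (dirDeriv f x h)) := by
  have hD : ContinuousAt (fun p : E × E => dirDeriv f p.1 p.2) (x, h) :=
    ContinuousOn.continuousAt hf.2.2 ((hU.prod isOpen_univ).mem_nhds ⟨hx, mem_univ _⟩)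
  intro W hW
  obtain ⟨W', hW', hW'c, hW'W⟩ := exists_mem_nhds_isClosed_subset hW
  obtain ⟨K, ⟨hK, hKc⟩, hKW⟩ :=
    ((LocallyConvexSpace.convex_basis (𝕜 := ℝ) (dirDeriv f x h)).mem_iff).1 hW'
  have hN : ∀ᶠ p : E × E in 𝓝 (x, h), p.1 ∈ U ∧ dirDeriv f p.1 p.2 ∈ K :=
    ((continuous_fst.tendsto (x, h)).eventually (hU.mem_nhds hx)).and (hD.eventually hK)
  have hm : Continuous (fun q : ℝ × E => (x + q.1 • q.2, q.2)) := by fun_prop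
  have hm0 := hm.tendsto (0, h)
  simp only [zero_smul, add_zero] at hm0
  have h3 := hm0.eventually hN
  rw [nhds_prod_eq, eventually_prod_iff] at h3
  obtain ⟨pa, hpa, pb, hpb, hab⟩ := h3
  obtain ⟨ε, hε, hball⟩ := Metric.eventually_nhds_iff.1 hpa
  have h4 : ∀ᶠ t : ℝ in 𝓝[≠] 0, |t| < ε ∧ t ≠ 0 := by
    refine Filter.Eventually.and ?_ self_mem_nhdsWithin
    refine nhdsWithin_le_nhds ?_
    filter_upwards [Metric.ball_mem_nhds (0 : ℝ) hε] with t ht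
    simpa using ht
  show ∀ᶠ p : ℝ × E in 𝓝[≠] 0 ×ˢ 𝓝 h, _ ∈ W
  rw [eventually_prod_iff]
  refine ⟨_, h4, pb, hpb, ?_⟩
  intro t ht k hk
  apply hW'W
  refine closure_minimal hKW hW'c ?_
  refine slope_mem ht.2 hKc.closure isClosed_closure fun s hs => ?_
  have hs' : |s| < ε := by
    have := Set.abs_sub_left_of_mem_uIcc hs
    simp only [sub_zero] at this
    exact this.trans_lt ht.1
  have h5 := hab (x := s) (hball (by simpa using hs')) hk
  exact ⟨_, subset_closure h5.2, hasDirDeriv_dirDeriv (hf.2.1 _ h5.1 k)⟩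

/-- Chain rule for directional derivatives. -/
theorem HasDirDeriv.comp {E' : Type*} [AddCommGroup E'] [Module ℝ E'] [TopologicalSpace E']
    {g : E → G} {f : E' → E} {U : Set E}
    (hU : IsOpen U) (hg : ContDiffMB 1 g U) {x h : E'} {y : E} (hf : HasDirDeriv f x h y)
    (hx : f x ∈ U) : HasDirDeriv (fun x => g (f x)) x h (dirDeriv g (f x) y) := by
  have h1 : Tendsto (fun t : ℝ => (t, t⁻¹ • (f (x + t • h) - f x))) (𝓝[≠] 0) (𝓝[≠] 0 ×ˢ 𝓝 y) :=
    tendsto_id.prodMk hf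
  refine ((tendsto_slope hU hg hx y).comp h1).congr' ?_
  filter_upwards [self_mem_nhdsWithin] with t ht
  simp [smul_inv_smul₀ (show t ≠ 0 from ht)]

end Chain

end Calculus

/-! ### Smooth manifolds modelled on locally convex spaces -/

section Manifold

variable (E : Type u) [AddCommGroup E] [Module ℝ E] [TopologicalSpace E]

/-- A smooth manifold modelled on `E`: all chart changes of the atlas are smooth. -/
class SmoothManifold (M : Type v) [TopologicalSpace M] [ChartedSpace E M] : Prop where
  smooth_change : ∀ e ∈ atlas E M, ∀ e' ∈ atlas E M,
    SmoothMB (fun y => e' (e.symm y)) (e.symm.trans e').source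

/-- Smooth maps between manifolds. -/
def MSmooth (E' : Type u) [AddCommGroup E'] [Module ℝ E'] [TopologicalSpace E']
    {M : Type v} [TopologicalSpace M] [ChartedSpace E M]
    {N : Type w} [TopologicalSpace N] [ChartedSpace E' N] (f : M → N) : Prop :=
  Continuous f ∧ ∀ e ∈ atlas E M, ∀ e' ∈ atlas E' N,
    SmoothMB (fun y => e' (f (e.symm y))) (e.target ∩ {y | f (e.symm y) ∈ e'.source})

/-- The tangent bundle `TM`. A tangent vector at `x` is recorded by its principal part `vec`
in the preferred chart `chartAt E x` at `x`; the charts `tangentChart` below give its principal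
part in an arbitrary chart. -/
@[ext]
structure TangentBdl (M : Type v) where
  pt : M
  vec : E

variable {E}
variable [IsTopologicalAddGroup E] [ContinuousSMul ℝ E] [LocallyConvexSpace ℝ E] [T2Space E]
variable {M : Type v} [TopologicalSpace M] [ChartedSpace E M]

/-- The derivative `D (e' ∘ e⁻¹) (y) (v)` of a change of charts. -/
def chartChange (e e' : OpenPartialHomeomorph M E) (y v : E) : E :=
  dirDeriv (fun z => e' (e.symm z)) y v

theorem isOpen_change (e e' : OpenPartialHomeomorph M E) : IsOpen (e.symm.trans e').source :=
  (e.symm.trans e').open_source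

theorem chartChange_self (e : OpenPartialHomeomorph M E) {y : E} (hy : y ∈ e.target) (v : E) :
    chartChange e e y v = v :=
  ((hasDirDeriv_id y v).congr e.open_target (fun _ hz => (e.right_inv hz).symm) hy).eq

variable [SmoothManifold E M]

theorem smooth_chart {e e' : OpenPartialHomeomorph M E} (he : e ∈ atlas E M)
    (he' : e' ∈ atlas E M) : SmoothMB (fun y => e' (e.symm y)) (e.symm.trans e').source :=
  SmoothManifold.smooth_change e he e' he'

theorem chartChange_comp {e e' e'' : OpenPartialHomeomorph M E} (he : e ∈ atlas E M)
    (he' : e' ∈ atlas E M) (he'' : e'' ∈ atlas E M) {y : E} (hy : y ∈ e.target)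
    (hy' : e.symm y ∈ e'.source) (hy'' : e.symm y ∈ e''.source) (v : E) :
    chartChange e' e'' (e' (e.symm y)) (chartChange e e' y v) = chartChange e e'' y v := by
  have hd : HasDirDeriv (fun y => e' (e.symm y)) y v (chartChange e e' y v) :=
    (smooth_chart he he').hasDirDeriv (by simp [hy, hy']) v
  have hc := hd.comp (isOpen_change e' e'') (smooth_chart he' he'' 1)
    (by simp [e'.map_source hy', e'.left_inv hy', hy''])
  refine ((hc.congr (isOpen_change e e') (fun z hz => ?_) (by simp [hy, hy'])).eq).symm
  simp only [OpenPartialHomeomorph.trans_source, OpenPartialHomeomorph.symm_source, mem_inter_iff,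
    mem_preimage] at hz
  simp [e'.left_inv hz.2]

/-- The chart `(x, v) ↦ (e x, v_e)` of `TM` induced by a chart `e` of `M`. -/
def tangentChart (e : atlas E M) : PartialEquiv (TangentBdl E M) (E × E) where
  toFun p := (e.1 p.pt, chartChange (chartAt E p.pt) e.1 (chartAt E p.pt p.pt) p.vec)
  invFun z := ⟨e.1.symm z.1, chartChange e.1 (chartAt E (e.1.symm z.1)) z.1 z.2⟩
  source := {p | p.pt ∈ e.1.source}
  target := e.1.target ×ˢ univ
  map_source' p hp := ⟨e.1.map_source hp, mem_univ _⟩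
  map_target' z hz := e.1.map_target hz.1
  left_inv' := by
    rintro ⟨x, v⟩ hp
    have hp' : x ∈ e.1.source := hp
    have hc := chartChange_comp (chart_mem_atlas E x) e.2 (chart_mem_atlas E x)
      (mem_chart_target E x) (by simpa using hp') (by simp) v
    simp only [OpenPartialHomeomorph.left_inv _ (mem_chart_source E x)] at hc
    simp only [e.1.left_inv hp']
    rw [hc, chartChange_self _ (mem_chart_target E x)]
  right_inv' := by
    rintro ⟨y, v⟩ hz
    have hy : y ∈ e.1.target := hz.1
    have hc := chartChange_comp e.2 (chart_mem_atlas E (e.1.symm y)) e.2 hy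
      (by simp) (e.1.map_target hy) v
    simp only [e.1.right_inv hy, hc, chartChange_self _ hy]

theorem tangentChart_change (e e' : atlas E M) :
    EqOn ((tangentChart e).symm.trans (tangentChart e'))
      (fun z => (e'.1 (e.1.symm z.1), chartChange e.1 e'.1 z.1 z.2))
      ((e.1.symm.trans e'.1).source ×ˢ univ) := by
  rintro ⟨y, v⟩ ⟨hy, -⟩
  simp only [OpenPartialHomeomorph.trans_source, OpenPartialHomeomorph.symm_source, mem_inter_iff,
    mem_preimage] at hy
  have := chartChange_comp e.2 (chart_mem_atlas E (e.1.symm y)) e'.2 hy.1 (by simp) hy.2 v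
  exact Prod.ext rfl this

theorem tangentChart_change_source (e e' : atlas E M) :
    ((tangentChart e).symm.trans (tangentChart e')).source =
      (e.1.symm.trans e'.1).source ×ˢ univ := by
  ext ⟨y, v⟩
  change ((y ∈ e.1.target ∧ True) ∧ e.1.symm y ∈ e'.1.source) ↔
    ((y ∈ e.1.target ∧ e.1.symm y ∈ e'.1.source) ∧ True)
  tauto

/-- The change of charts `(y, v) ↦ (τ y, D τ (y) (v))` of the tangent bundle is smooth. -/
theorem tangent_change_smooth {e e' : OpenPartialHomeomorph M E} (he : e ∈ atlas E M)
    (he' : e' ∈ atlas E M) :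
    SmoothMB (fun z : E × E => (e' (e.symm z.1), chartChange e e' z.1 z.2))
      ((e.symm.trans e').source ×ˢ univ) := by
  intro n
  refine ContDiffMB.prodMk ((isOpen_change e e').prod isOpen_univ) ?_ ?_
  · exact (smooth_chart he he' n).comp_clm (ContinuousLinearMap.fst ℝ E E) (fun p hp => hp.1)
  · exact (smooth_chart he he').dirDeriv n

variable (E M) in
/-- The atlas of `TM` consisting of the charts induced by the charts of `M`. -/
def tangentCore : ChartedSpaceCore (E × E) (TangentBdl E M) where
  atlas := range (tangentChart (E := E) (M := M))
  chartAt p := tangentChart ⟨chartAt E p.pt, chart_mem_atlas E p.pt⟩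
  mem_chart_source p := mem_chart_source E p.pt
  chart_mem_atlas p := mem_range_self _
  open_source := by
    rintro _ _ ⟨e, rfl⟩ ⟨e', rfl⟩
    rw [tangentChart_change_source]
    exact (isOpen_change e.1 e'.1).prod isOpen_univ
  continuousOn_toFun := by
    rintro _ _ ⟨e, rfl⟩ ⟨e', rfl⟩
    rw [tangentChart_change_source]
    exact (tangent_change_smooth e.2 e'.2).continuousOn.congr (tangentChart_change e e')

instance : TopologicalSpace (TangentBdl E M) := (tangentCore E M).toTopologicalSpace

instance : ChartedSpace (E × E) (TangentBdl E M) := (tangentCore E M).toChartedSpace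

/-- The chart of `TM` induced by a chart of `M`, as an open partial homeomorphism. -/
def tangentHomeo (e : atlas E M) : OpenPartialHomeomorph (TangentBdl E M) (E × E) :=
  (tangentCore E M).openPartialHomeomorph (tangentChart e) (mem_range_self e)

theorem mem_atlas_tangent {Φ : OpenPartialHomeomorph (TangentBdl E M) (E × E)} :
    Φ ∈ atlas (E × E) (TangentBdl E M) ↔ ∃ e : atlas E M, Φ = tangentHomeo e := by
  constructor
  · intro h
    obtain ⟨_, ⟨⟨e, rfl⟩, rfl⟩⟩ : ∃ e, ∃ he, Φ = (tangentCore E M).openPartialHomeomorph e he := by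
      simpa [atlas, ChartedSpace.atlas, ChartedSpaceCore.toChartedSpace] using h
    exact ⟨e, rfl⟩
  · rintro ⟨e, rfl⟩
    simp only [atlas, ChartedSpace.atlas, mem_iUnion, mem_singleton_iff]
    exact ⟨_, mem_range_self e, rfl⟩

instance : SmoothManifold (E × E) (TangentBdl E M) where
  smooth_change := by
    intro Φ hΦ Φ' hΦ'
    obtain ⟨e, rfl⟩ := mem_atlas_tangent.1 hΦ
    obtain ⟨e', rfl⟩ := mem_atlas_tangent.1 hΦ'
    have hs : ((tangentHomeo e).symm.trans (tangentHomeo e')).source =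
        (e.1.symm.trans e'.1).source ×ˢ univ := tangentChart_change_source e e'
    rw [hs]
    intro n
    exact (tangent_change_smooth e.2 e'.2 n).congr ((isOpen_change e.1 e'.1).prod isOpen_univ)
      (fun z hz => (tangentChart_change e e' hz).symm)

end Manifold

/-- The tangent map `T f : TM → TN` of a map `f : M → N`. -/
def tangentMap (E : Type u) [AddCommGroup E] [Module ℝ E] [TopologicalSpace E]
    (E' : Type u) [AddCommGroup E'] [Module ℝ E'] [TopologicalSpace E']
    {M : Type v} [TopologicalSpace M] [ChartedSpace E M]
    {N : Type w} [TopologicalSpace N] [ChartedSpace E' N] (f : M → N) (p : TangentBdl E M) :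
    TangentBdl E' N :=
  ⟨f p.pt, dirDeriv (fun y => chartAt E' (f p.pt) (f ((chartAt E p.pt).symm y)))
    (chartAt E p.pt p.pt) p.vec⟩

/-! ### The double tangent bundle and the second-order tangent bundle -/

section Second

variable (F : Type u) [AddCommGroup F] [Module ℝ F] [TopologicalSpace F]
  [IsTopologicalAddGroup F] [ContinuousSMul ℝ F] [LocallyConvexSpace ℝ F] [T2Space F]
  (M : Type v) [TopologicalSpace M] [ChartedSpace F M] [SmoothManifold F M]

/-- The double tangent bundle `T(TM)`. -/
abbrev DoubleTangent := TangentBdl (F × F) (TangentBdl F M)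

variable {F M}

/-- The tangent map `TΠ : T(TM) → TM` of the projection `Π : TM → M`. -/
def tangentProj (ξ : DoubleTangent F M) : TangentBdl F M :=
  tangentMap (F × F) F (fun p : TangentBdl F M => p.pt) ξ

theorem tangentProj_eq (ξ : DoubleTangent F M) : tangentProj ξ = ⟨ξ.pt.pt, ξ.vec.1⟩ := by
  have h : HasDirDeriv (fun y : F × F => y.1) (chartAt (F × F) ξ.pt ξ.pt) ξ.vec ξ.vec.1 :=
    (hasDirDeriv_id _ ξ.vec).clm_comp (ContinuousLinearMap.fst ℝ F F)
  have h2 := h.congr (g := fun y => chartAt F ξ.pt.pt (((chartAt (F × F) ξ.pt).symm y).pt))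
    (chartAt (F × F) ξ.pt).open_target
    (fun y hy => ((chartAt F ξ.pt.pt).right_inv hy.1).symm) (mem_chart_target _ _)
  exact congrArg (TangentBdl.mk ξ.pt.pt) h2.eq

variable (F M) in
/-- The second-order tangent bundle `T²M`: the set of those `ξ ∈ T(TM)` with
`Π_{TM} ξ = TΠ_M ξ` (in a chart: `(x, v, v, w)`), with the subspace topology. Such an element is
the 2-jet of the curves with velocity `v` and acceleration `w` at `x`. -/
def SecondTangent := {ξ : DoubleTangent F M // ξ.pt = tangentProj ξ}

instance : TopologicalSpace (SecondTangent F M) :=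
  inferInstanceAs (TopologicalSpace {ξ : DoubleTangent F M // ξ.pt = tangentProj ξ})

/-- The element `(x, v, v, w)` of `T²M`, in the preferred chart at `x`. -/
def SecondTangent.mk' (x : M) (v w : F) : SecondTangent F M :=
  ⟨⟨⟨x, v⟩, (v, w)⟩, (tangentProj_eq (F := F) (M := M) ⟨⟨x, v⟩, (v, w)⟩).symm⟩

theorem SecondTangent.vec_fst (ξ : SecondTangent F M) : ξ.1.vec.1 = ξ.1.pt.vec := by
  have h := ξ.2
  rw [tangentProj_eq] at h
  exact (congrArg TangentBdl.vec h).symm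

theorem SecondTangent.eta (ξ : SecondTangent F M) :
    SecondTangent.mk' ξ.1.pt.pt ξ.1.pt.vec ξ.1.vec.2 = ξ := by
  apply Subtype.ext
  have h := ξ.vec_fst
  rcases ξ with ⟨⟨⟨x, v⟩, ⟨u, w⟩⟩, hξ⟩
  simp only at h
  subst h
  rfl

/-- The chart of `T(TM)` induced by a chart of `M`. -/
def doubleHomeo (e : atlas F M) : OpenPartialHomeomorph (DoubleTangent F M) ((F × F) × (F × F)) :=
  tangentHomeo ⟨tangentHomeo e, mem_atlas_tangent.2 ⟨e, rfl⟩⟩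

theorem chartChange_tangentHomeo_fst (e e' : atlas F M) {z : F × F}
    (hz : z.1 ∈ (e.1.symm.trans e'.1).source) (ζ : F × F) :
    (chartChange (tangentHomeo e) (tangentHomeo e') z ζ).1 = chartChange e.1 e'.1 z.1 ζ.1 := by
  have hU := (isOpen_change e.1 e'.1).prod (isOpen_univ (X := F))
  have hs : ((tangentHomeo e).symm.trans (tangentHomeo e')).source =
      (e.1.symm.trans e'.1).source ×ˢ univ := tangentChart_change_source e e'
  have h1 := ((smooth_chart (mem_atlas_tangent.2 ⟨e, rfl⟩)
    (mem_atlas_tangent.2 ⟨e', rfl⟩)).hasDirDeriv (hs ▸ ⟨hz, mem_univ _⟩ :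
      z ∈ ((tangentHomeo e).symm.trans (tangentHomeo e')).source) ζ).clm_comp
    (ContinuousLinearMap.fst ℝ F F)
  have h2 : HasDirDeriv (fun y : F × F => e'.1 (e.1.symm y.1)) z ζ
      (chartChange e.1 e'.1 z.1 ζ.1) :=
    (smooth_chart e.2 e'.2).hasDirDeriv hz ζ.1
  have h3 := h2.congr hU
    (g := fun y => ((tangentHomeo e' ((tangentHomeo e).symm y)).1)) (fun y _ => rfl)
    ⟨hz, mem_univ _⟩
  exact h1.eq.symm.trans h3.eq

/-- The inclusion `(x, v, w) ↦ (x, v, v, w)`. -/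
def jetIncl : (F × F × F) →L[ℝ] ((F × F) × (F × F)) :=
  let x := ContinuousLinearMap.fst ℝ F (F × F)
  let v := (ContinuousLinearMap.fst ℝ F F).comp (ContinuousLinearMap.snd ℝ F (F × F))
  let w := (ContinuousLinearMap.snd ℝ F F).comp (ContinuousLinearMap.snd ℝ F (F × F))
  (x.prod v).prod (v.prod w)

/-- The projection `(x, v, u, w) ↦ (x, v, w)`. -/
def jetPr : ((F × F) × (F × F)) →L[ℝ] (F × F × F) :=
  let p := ContinuousLinearMap.fst ℝ (F × F) (F × F)
  let q := ContinuousLinearMap.snd ℝ (F × F) (F × F)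
  ((ContinuousLinearMap.fst ℝ F F).comp p).prod
    (((ContinuousLinearMap.snd ℝ F F).comp p).prod ((ContinuousLinearMap.snd ℝ F F).comp q))

/-- The element of `T²M` obtained from `(x, v, u, w)` by replacing `u` with `v`. -/
def symmetrise (ζ : DoubleTangent F M) : SecondTangent F M :=
  SecondTangent.mk' ζ.pt.pt ζ.pt.vec ζ.vec.2

theorem doubleHomeo_jet (e : atlas F M) (ξ : SecondTangent F M) (h : ξ.1.pt.pt ∈ e.1.source) :
    jetIncl (jetPr (doubleHomeo e ξ.1)) = doubleHomeo e ξ.1 := by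
  set c : atlas F M := ⟨chartAt F ξ.1.pt.pt, chart_mem_atlas F ξ.1.pt.pt⟩
  have h1 : (doubleHomeo e ξ.1).2.1 = (doubleHomeo e ξ.1).1.2 := by
    refine (chartChange_tangentHomeo_fst c e (z := chartAt (F × F) ξ.1.pt ξ.1.pt) ?_
      ξ.1.vec).trans ?_
    · refine ⟨mem_chart_target F ξ.1.pt.pt, ?_⟩
      change (chartAt F ξ.1.pt.pt).symm (chartAt F ξ.1.pt.pt ξ.1.pt.pt) ∈ e.1.source
      rwa [(chartAt F ξ.1.pt.pt).left_inv (mem_chart_source _ _)]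
    · rw [ξ.vec_fst]
      rfl
  exact Prod.ext rfl (Prod.ext h1.symm rfl)

theorem symmetrise_symm (e : atlas F M) {y : F × F × F} (hy : y.1 ∈ e.1.target) :
    (symmetrise ((doubleHomeo e).symm (jetIncl y))).1 = (doubleHomeo e).symm (jetIncl y) := by
  set c : atlas F M := ⟨chartAt F (e.1.symm y.1), chart_mem_atlas F _⟩
  have h1 : ((doubleHomeo e).symm (jetIncl y)).vec.1 =
      ((doubleHomeo e).symm (jetIncl y)).pt.vec :=
    chartChange_tangentHomeo_fst e c (z := (y.1, y.2.1)) ⟨hy, mem_chart_source _ _⟩ y.2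
  refine TangentBdl.ext rfl (Prod.ext h1.symm rfl)

/-- The chart `(x, v, w)` of `T²M` induced by a chart `e` of `M`: the restriction to `T²M` of the
chart `(x, v, u, w)` of `T(TM)`. -/
def secondHomeo (e : atlas F M) : OpenPartialHomeomorph (SecondTangent F M) (F × F × F) where
  toFun ξ := jetPr (doubleHomeo e ξ.1)
  invFun y := symmetrise ((doubleHomeo e).symm (jetIncl y))
  source := {ξ | ξ.1.pt.pt ∈ e.1.source}
  target := e.1.target ×ˢ univ
  map_source' ξ hξ := ⟨e.1.map_source hξ, mem_univ _⟩
  map_target' y hy := e.1.map_target hy.1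
  left_inv' ξ hξ := by
    change symmetrise _ = _
    rw [doubleHomeo_jet e ξ hξ, (doubleHomeo e).left_inv hξ]
    exact ξ.eta
  right_inv' y hy := by
    rw [symmetrise_symm e hy.1, (doubleHomeo e).right_inv ⟨⟨hy.1, mem_univ _⟩, mem_univ _⟩]
    rfl
  open_source := (doubleHomeo e).open_source.preimage continuous_subtype_val
  open_target := e.1.open_target.prod isOpen_univ
  continuousOn_toFun := jetPr.continuous.comp_continuousOn
    ((doubleHomeo e).continuousOn.comp continuous_subtype_val.continuousOn (fun _ h => h))
  continuousOn_invFun := by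
    refine Topology.IsInducing.subtypeVal.continuousOn_iff.2 ?_
    refine ((doubleHomeo e).continuousOn_symm.comp jetIncl.continuous.continuousOn
      (fun y hy => ⟨⟨hy.1, mem_univ _⟩, mem_univ _⟩)).congr (fun y hy => symmetrise_symm e hy.1)

instance : ChartedSpace (F × F × F) (SecondTangent F M) where
  atlas := range (secondHomeo (F := F) (M := M))
  chartAt ξ := secondHomeo ⟨chartAt F ξ.1.pt.pt, chart_mem_atlas F _⟩
  mem_chart_source ξ := mem_chart_source F ξ.1.pt.pt
  chart_mem_atlas _ := mem_range_self _

instance : SmoothManifold (F × F × F) (SecondTangent F M) where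
  smooth_change := by
    rintro _ ⟨e, rfl⟩ _ ⟨e', rfl⟩ n
    have hmaps : MapsTo (jetIncl (F := F)) ((secondHomeo e).symm.trans (secondHomeo e')).source
        ((doubleHomeo e).symm.trans (doubleHomeo e')).source :=
      fun y hy => ⟨⟨⟨hy.1.1, mem_univ _⟩, mem_univ _⟩, hy.2⟩
    have h1 := ContDiffMB.comp_clm jetIncl hmaps
      (smooth_chart (mem_atlas_tangent.2 ⟨⟨tangentHomeo e, mem_atlas_tangent.2 ⟨e, rfl⟩⟩, rfl⟩)
        (mem_atlas_tangent.2 ⟨⟨tangentHomeo e', mem_atlas_tangent.2 ⟨e', rfl⟩⟩, rfl⟩) n)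
    have ho := (((secondHomeo e).symm.trans (secondHomeo e')).open_source)
    refine (h1.clm_comp jetPr ho).congr ho (fun y hy => ?_)
    change _ = jetPr (doubleHomeo e' (symmetrise ((doubleHomeo e).symm (jetIncl y))).1)
    rw [symmetrise_symm e hy.1.1]
    rfl

end Second

/-! ### Vector bundles and linear connections -/

section Bundle

/-- A map `proj : V → M` whose fibres are real vector spaces. -/
structure VectorFibration (M : Type v) (V : Type w) where
  proj : V → M
  addCommGroup : ∀ x, AddCommGroup {p : V // proj p = x}
  module : ∀ x, Module ℝ {p : V // proj p = x}

attribute [instance] VectorFibration.addCommGroup VectorFibration.module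

/-- The fibre of `V` over `x`. -/
abbrev VectorFibration.Fibre {M : Type v} {V : Type w} (B : VectorFibration M V) (x : M) :=
  {p : V // B.proj p = x}

-- `M` is modelled on `F`, the typical fibre is `G`, and `V` is a manifold modelled on `H`.
variable (F : Type u) [AddCommGroup F] [Module ℝ F] [TopologicalSpace F]
  (G : Type u) [AddCommGroup G] [Module ℝ G] [TopologicalSpace G]
  (H : Type u) [AddCommGroup H] [Module ℝ H] [TopologicalSpace H]
  {M : Type v} [TopologicalSpace M] [ChartedSpace F M]
  {V : Type w} [TopologicalSpace V] [ChartedSpace H V]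

namespace VectorFibration

variable (B : VectorFibration M V)

/-- `Φ` is a vector bundle chart of `V` over the domain `U` of the chart `e` of `M`: a
diffeomorphism of `Π⁻¹(U)` onto `e(U) × G` which covers `e` and is linear on the fibres. -/
structure IsBundleChart (e : OpenPartialHomeomorph M F) (Φ : OpenPartialHomeomorph V (F × G)) :
    Prop where
  mem_atlas : e ∈ atlas F M
  source_eq : Φ.source = {p | B.proj p ∈ e.source}
  target_eq : Φ.target = e.target ×ˢ univ
  fst_eq : ∀ p ∈ Φ.source, (Φ p).1 = e (B.proj p)
  linear : ∀ x ∈ e.source, IsLinearMap ℝ (fun p : B.Fibre x => (Φ p.1).2)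
  smooth : ∀ c ∈ atlas H V, SmoothMB (fun y => Φ (c.symm y)) (c.symm.trans Φ).source
  smooth_symm : ∀ c ∈ atlas H V, SmoothMB (fun y => c (Φ.symm y)) (Φ.symm.trans c).source

/-- `V` is a smooth vector bundle over `M` with typical fibre `G`. -/
def IsVectorBundle : Prop :=
  MSmooth H F B.proj ∧
    ∀ x : M, ∃ (e : OpenPartialHomeomorph M F) (Φ : OpenPartialHomeomorph V (F × G)),
      x ∈ e.source ∧ B.IsBundleChart F G H e Φ

/-- The tangent map `TΠ : TV → TM` of the bundle projection. -/
def tproj (ξ : TangentBdl H V) : TangentBdl F M := tangentMap H F B.proj ξ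

/-- The vertical lift: the velocity at `t = 0` of the curve `t ↦ p + t q` in the fibre. -/
def verticalLift {x : M} (p q : B.Fibre x) : TangentBdl H V :=
  ⟨p.1, dirDeriv (fun t : ℝ => chartAt H p.1 (p + t • q : B.Fibre x).1) 0 1⟩

/-- The fibre coordinate `D (pr₂ ∘ Φ) (ξ) ∈ G` of the tangent vector `ξ` in a bundle chart `Φ`. -/
def fibreDeriv (Φ : OpenPartialHomeomorph V (F × G)) (ξ : TangentBdl H V) : G :=
  dirDeriv (fun y => (Φ ((chartAt H ξ.pt).symm y)).2) (chartAt H ξ.pt ξ.pt) ξ.vec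

/-- `ζ = a ξ + b η` for the vector space structure on the fibres of `TΠ : TV → TM`. In a bundle
chart of `V` the elements of such a fibre are `(x, p, u, w)` with `(x, u)` fixed, and the
structure is the one of the pairs `(p, w) ∈ G × G`. -/
def IsTangentComb (a b : ℝ) (ξ η ζ : TangentBdl H V) : Prop :=
  B.tproj F H ξ = B.tproj F H ζ ∧ B.tproj F H η = B.tproj F H ζ ∧
    ∀ (e : OpenPartialHomeomorph M F) (Φ : OpenPartialHomeomorph V (F × G)),
      B.IsBundleChart F G H e Φ → B.proj ζ.pt ∈ e.source →
        (Φ ζ.pt).2 = a • (Φ ξ.pt).2 + b • (Φ η.pt).2 ∧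
        fibreDeriv F G H Φ ζ = a • fibreDeriv F G H Φ ξ + b • fibreDeriv F G H Φ η

variable [IsTopologicalAddGroup H] [ContinuousSMul ℝ H] [LocallyConvexSpace ℝ H] [T2Space H]
  [SmoothManifold H V]

/-- A smooth connection on `V`: a smooth vector bundle morphism `C : TV → VV` over `V` onto the
vertical bundle `VV = ker TΠ`, regarded as a map `TV → TV`, which is the identity on `VV`, that
is, a left splitting of `0 → VV → TV → Π^* TM → 0`. -/
structure IsConnection (C : TangentBdl H V → TangentBdl H V) : Prop where
  smooth : MSmooth (H × H) (H × H) C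
  pt_eq : ∀ ξ, (C ξ).pt = ξ.pt
  linear : ∀ p : V, IsLinearMap ℝ (fun z : H => (C ⟨p, z⟩).vec)
  vertical : ∀ ξ, (B.tproj F H (C ξ)).vec = 0
  of_vertical : ∀ ξ, (B.tproj F H ξ).vec = 0 → C ξ = ξ

/-- A linear connection: a connection which is also linear on the fibres of `TΠ`. -/
structure IsLinearConnection (C : TangentBdl H V → TangentBdl H V) : Prop
    extends B.IsConnection F H C where
  linear_tproj : ∀ (a b : ℝ) (ξ η ζ : TangentBdl H V),
    B.IsTangentComb F G H a b ξ η ζ → B.IsTangentComb F G H a b (C ξ) (C η) (C ζ)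

/-- Two vertical vectors of `V`, possibly with different base points in the same fibre of `V`,
are vertical lifts of the same vector `q ∈ V`, that is, they have the same image under
`VV ≅ V ⊕ V → V`, `(p, q) ↦ q`. -/
def SameVerticalPart (ξ η : TangentBdl H V) : Prop :=
  ∃ (x : M) (p p' q : B.Fibre x), ξ = B.verticalLift H p q ∧ η = B.verticalLift H p' q

end VectorFibration

end Bundle

/-! ### Sprays, and the vector bundles `TM` and `T²M` -/

section Spray

variable {F : Type u} [AddCommGroup F] [Module ℝ F] [TopologicalSpace F]
  [IsTopologicalAddGroup F] [ContinuousSMul ℝ F] [LocallyConvexSpace ℝ F] [T2Space F]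
  {M : Type v} [TopologicalSpace M] [ChartedSpace F M] [SmoothManifold F M]

/-- The identification of the fibre `T_x M` with `F` given by the preferred chart at `x`. -/
def tangentFibreEquiv (x : M) : {p : TangentBdl F M // p.pt = x} ≃ F where
  toFun p := p.1.vec
  invFun v := ⟨⟨x, v⟩, rfl⟩
  left_inv := by rintro ⟨⟨y, v⟩, rfl⟩; rfl
  right_inv _ := rfl

variable (F M) in
/-- The tangent bundle `TM → M` with its fibrewise vector space structure. -/
def tangentVB : VectorFibration M (TangentBdl F M) where
  proj p := p.pt
  addCommGroup x := (tangentFibreEquiv x).addCommGroup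
  module x :=
    letI := (tangentFibreEquiv (F := F) x).addCommGroup
    (tangentFibreEquiv x).module ℝ

/-- Scalar multiplication by `s` on the fibres of a tangent bundle. -/
def scale {E : Type u} [AddCommGroup E] [Module ℝ E] {N : Type v} (s : ℝ)
    (p : TangentBdl E N) : TangentBdl E N :=
  ⟨p.pt, s • p.vec⟩

/-- A (smooth) spray: a second-order vector field `S : TM → T(TM)` such that
`S (s v) = (L_s)_* (s S (v))`, where `L_s` is the multiplication by `s` on `TM`. -/
structure IsSpray (S : TangentBdl F M → DoubleTangent F M) : Prop where
  smooth : MSmooth (F × F) ((F × F) × (F × F)) S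
  pt_eq : ∀ p, (S p).pt = p
  second_order : ∀ p, tangentProj (S p) = p
  homogeneous : ∀ (s : ℝ) (p : TangentBdl F M),
    S (scale s p) = tangentMap (F × F) (F × F) (scale s : TangentBdl F M → TangentBdl F M)
      (scale s (S p))

/-- The symmetric bilinear map `B (x; v, w) = (1/2) D₂² S₂ (x, 0) (v, w)` associated with a spray,
in the preferred chart at `x`, where `S (x, v) = (x, v, v, S₂ (x, v))`. -/
def sprayBilin (S : TangentBdl F M → DoubleTangent F M) (x : M) (v w : F) : F :=
  (1 / 2 : ℝ) • dirDeriv (fun a : F => dirDeriv (fun b : F => (S ⟨x, b⟩).vec.2) a v) 0 w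

/-- The connection map `K : T(TM) → TM`, `K (x, v, u, w) = (x, w - B (x; v, u))`, associated
with a spray. -/
def connectionMap (S : TangentBdl F M → DoubleTangent F M) (ξ : DoubleTangent F M) :
    TangentBdl F M :=
  ⟨ξ.pt.pt, ξ.vec.2 - sprayBilin S ξ.pt.pt ξ.pt.vec ξ.vec.1⟩

/-- The bijection `(Π_{TM}, K)` of the fibre of `T²M` over `x` onto `T_x M × T_x M`. -/
def secondFibreEquiv (S : TangentBdl F M → DoubleTangent F M) (x : M) :
    {ξ : SecondTangent F M // ξ.1.pt.pt = x} ≃ F × F where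
  toFun ξ := (ξ.1.1.pt.vec, (connectionMap S ξ.1.1).vec)
  invFun z := ⟨SecondTangent.mk' x z.1 (z.2 + sprayBilin S x z.1 z.1), rfl⟩
  left_inv := by
    rintro ⟨ξ, rfl⟩
    apply Subtype.ext
    simp only [connectionMap, ξ.vec_fst, sub_add_cancel]
    exact ξ.eta
  right_inv z := by simp [connectionMap, SecondTangent.mk']

/-- The vector bundle structure induced by a spray on `T²M → M`: the one for which
`(Π_{TM}, K) : T²M → TM ⊕ TM` is a linear isomorphism on the fibres. -/
def secondVB (S : TangentBdl F M → DoubleTangent F M) :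
    VectorFibration M (SecondTangent F M) where
  proj ξ := ξ.1.pt.pt
  addCommGroup x := (secondFibreEquiv S x).addCommGroup
  module x :=
    letI := (secondFibreEquiv S x).addCommGroup
    (secondFibreEquiv S x).module ℝ

/-- The two projections `T²M → TM` of `T²M ≅ TM ⊕ TM`, namely `Π_{TM}` and `K`. -/
def secondPr (S : TangentBdl F M → DoubleTangent F M) (i : Fin 2) (ξ : SecondTangent F M) :
    TangentBdl F M :=
  if i = 0 then ξ.1.pt else connectionMap S ξ.1

/-- The two inclusions `TM → T²M` of `T²M ≅ TM ⊕ TM`, as first and as second summand. -/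
def secondIncl (S : TangentBdl F M → DoubleTangent F M) (i : Fin 2) (p : TangentBdl F M) :
    SecondTangent F M :=
  ((secondFibreEquiv S p.pt).symm (if i = 0 then (p.vec, 0) else (0, p.vec))).1

/-- The canonical involution of `T(TM)`, `(x, v, u, w) ↦ (x, u, v, w)`. -/
def canonicalInv (ξ : DoubleTangent F M) : DoubleTangent F M :=
  ⟨⟨ξ.pt.pt, ξ.vec.1⟩, (ξ.pt.vec, ξ.vec.2)⟩

/-- A linear connection `C` on `TM` is symmetric if `C ∘ Inv = C`, where vertical vectors are
compared through `V(TM) ≅ TM ⊕ TM → TM`. -/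
def IsSymmetricTM (C : DoubleTangent F M → DoubleTangent F M) : Prop :=
  ∀ ξ, (tangentVB F M).SameVerticalPart (F × F) (C (canonicalInv ξ)) (C ξ)

/-- A linear connection `C` on `T²M ≅ TM ⊕ TM` is symmetric if, for both inclusions
`ι : TM → T²M`, the map `C ∘ Tι` on `T(TM)` is invariant under the canonical involution, where
vertical vectors are compared through `V(T²M) ≅ T²M ⊕ T²M → T²M`. -/
def IsSymmetricSecond (S : TangentBdl F M → DoubleTangent F M)
    (C : TangentBdl (F × F × F) (SecondTangent F M) → TangentBdl (F × F × F) (SecondTangent F M)) :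
    Prop :=
  ∀ (i : Fin 2) (ξ : DoubleTangent F M), (secondVB S).SameVerticalPart (F × F × F)
    (C (tangentMap (F × F) (F × F × F) (secondIncl S i) (canonicalInv ξ)))
    (C (tangentMap (F × F) (F × F × F) (secondIncl S i) ξ))

end Spray

end

end FrechetGeometry

namespace FrechetGeometry

/-! ### Further calculus: linear maps, composition, linearity of the derivative -/

section Calculus

/-! The point is that a spray splits `T²M` as `TM ⊕ TM`. Two elements of `T²M` over the same `p ∈
TM` have the same image under `TΠ`, so they differ by a vertical vector, and `S p` is one such
element. Hence `ξ ↦ ξ - S (Π ξ)` takes values in `TM` without any choice of chart. By homogeneity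
`S₂(x, v) = B(x; v, v)`, so this difference is `K ξ` (`IsSpray.sprayBilin_self`,
`along_secondPr_one`). In a natural chart `(Π, K)` is the shear `(x, v, w) ↦ (x, v, w - S₂(x, v))`;
composing the natural charts with it gives charts that are linear on the fibres
(`exists_isBundleChart_second`), which is (0), and `second_isBundleSum` records the splitting.

The rest holds for any direct sum `B ⊕ B`. A tangent vector of the sum is determined by its base
point and its two images under `T pr_i` (`IsBundleSum.ext_tangent`), which gives uniqueness in (1).
For existence, the two vectors `C (T pr_i ξ)` are both vertical, so they are the components of one
vertical vector `D ξ` at the base point of `ξ` (`IsBundleSum.exists_tangent`). Smoothness and both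
linearity properties of `D` are checked component by component. Linearity of `C` on the fibres of
`TΠ` makes it send tangent vectors of the zero section to zero, whence `D ∘ Tι_i = Tι_i ∘ C`; as
`Tι_i` maps vertical lifts of one `q` to vertical lifts of one vector, symmetry passes from `C` to
`D`.

For (2), `T pr_i ∘ D ∘ Tι_i` inherits every clause because tangent maps of bundle maps commute with
`TΠ`, respect vertical lifts, and preserve the linear structure on the fibres of `TΠ`
(`IsBundleMap.isTangentComb`). The last fact reduces to differentiating a map that is linear in its
second variable. -/

theorem ContDiffMB.clm {G : Type w} [AddCommGroup G] [Module ℝ G] [TopologicalSpace G] [T2Space G]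
    (n : ℕ) : ∀ {E : Type u} [AddCommGroup E] [Module ℝ E] [TopologicalSpace E]
      [ContinuousAdd E] [ContinuousSMul ℝ E] (A : E →L[ℝ] G) (U : Set E),
      ContDiffMB n (fun x => A x) U := by
  induction n with
  | zero => intro E _ _ _ _ _ A U; exact A.continuous.continuousOn
  | succ n ih =>
    intro E _ _ _ _ _ A U
    have h1 (x h : E) : HasDirDeriv (fun x => A x) x h (A h) := (hasDirDeriv_id x h).clm_comp A
    refine ⟨A.continuous.continuousOn, fun x _ h => ⟨_, h1 x h⟩, ?_⟩
    have h2 : (fun p : E × E => dirDeriv (fun x => A x) p.1 p.2) =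
        fun p => A.comp (ContinuousLinearMap.snd ℝ E E) p := funext fun p => (h1 p.1 p.2).eq
    rw [h2]
    exact ih _ _

theorem ContDiffMB.of_succ {G : Type w} [AddCommGroup G] [Module ℝ G] [TopologicalSpace G]
    {n : ℕ} : ∀ {E : Type u} [AddCommGroup E] [Module ℝ E] [TopologicalSpace E]
      {f : E → G} {U : Set E}, ContDiffMB (n + 1) f U → ContDiffMB n f U := by
  induction n with
  | zero => intro E _ _ _ f U H; exact H.1
  | succ n ih => intro E _ _ _ f U H; exact ⟨H.1, H.2.1, ih H.2.2⟩

/-- Induction on the order: `D(g ∘ f)(x, h) = Dg(f x, Df(x, h))` is the composite of `Dg` with `(f ∘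
fst, Df)`, and both factors have one order of differentiability less. The universally quantified
spaces in the induction are needed because this step doubles both of them. -/
theorem ContDiffMB.comp {G : Type w} [AddCommGroup G] [Module ℝ G] [TopologicalSpace G]
    [IsTopologicalAddGroup G] [ContinuousSMul ℝ G] [LocallyConvexSpace ℝ G] [T2Space G]
    {n : ℕ} : ∀ {E E' : Type u} [AddCommGroup E] [Module ℝ E] [TopologicalSpace E]
      [IsTopologicalAddGroup E] [ContinuousSMul ℝ E]
      [AddCommGroup E'] [Module ℝ E'] [TopologicalSpace E']
      [IsTopologicalAddGroup E'] [ContinuousSMul ℝ E'] [T2Space E']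
      {g : E' → G} {f : E → E'} {U : Set E} {U' : Set E'}, IsOpen U → IsOpen U' →
      ContDiffMB n g U' → ContDiffMB n f U → MapsTo f U U' →
      ContDiffMB n (fun x => g (f x)) U := by
  induction n with
  | zero =>
    intro E E' _ _ _ _ _ _ _ _ _ _ _ g f U U' _ _ hg hf hm
    exact ContinuousOn.comp hg hf hm
  | succ n ih =>
    intro E E' _ _ _ _ _ _ _ _ _ _ _ g f U U' hU hU' hg hf hm
    -- The chain rule for directional derivatives needs only continuity of `Dg`, available whatever
    -- `n` is.
    have hg1 : ContDiffMB 1 g U' := ⟨hg.1, hg.2.1, hg.2.2.continuousOn⟩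
    have hd (x : E) (hx : x ∈ U) (h : E) :
        HasDirDeriv (fun x => g (f x)) x h (FrechetGeometry.dirDeriv g (f x)
          (FrechetGeometry.dirDeriv f x h)) :=
      (hasDirDeriv_dirDeriv (hf.2.1 x hx h)).comp hU' hg1 (hm hx)
    refine ⟨hg.1.comp hf.1 hm, fun x hx h => ⟨_, hd x hx h⟩, ?_⟩
    have ho : IsOpen (U ×ˢ (univ : Set E)) := hU.prod isOpen_univ
    have hfst : ContDiffMB n (fun p : E × E => f p.1) (U ×ˢ univ) :=
      hf.of_succ.comp_clm (ContinuousLinearMap.fst ℝ E E) fun p hp => hp.1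
    exact (ih (E := E × E) (E' := E' × E') ho (hU'.prod isOpen_univ) hg.2.2
      (hfst.prodMk ho hf.2.2) fun p hp => ⟨hm hp.1, mem_univ _⟩).congr ho
        fun p hp => (hd p.1 hp.1 p.2).eq.symm

theorem ContDiffMB.of_locally {G : Type w} [AddCommGroup G] [Module ℝ G] [TopologicalSpace G]
    {n : ℕ} : ∀ {E : Type u} [AddCommGroup E] [Module ℝ E] [TopologicalSpace E]
      {f : E → G} {U : Set E},
      (∀ x ∈ U, ∃ V, IsOpen V ∧ x ∈ V ∧ ContDiffMB n f V) → ContDiffMB n f U := by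
  have hc {E : Type u} [TopologicalSpace E] {f : E → G} {U : Set E}
      (H : ∀ x ∈ U, ∃ V, IsOpen V ∧ x ∈ V ∧ ContinuousOn f V) : ContinuousOn f U := by
    intro x hx
    obtain ⟨V, hV, hxV, hf⟩ := H x hx
    exact (hf.continuousAt (hV.mem_nhds hxV)).continuousWithinAt
  induction n with
  | zero => intro E _ _ _ f U H; exact hc H
  | succ n ih =>
    intro E _ _ _ f U H
    refine ⟨hc fun x hx => ?_, fun x hx h => ?_, ih fun p hp => ?_⟩
    · obtain ⟨V, hV, hxV, hf⟩ := H x hx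
      exact ⟨V, hV, hxV, hf.1⟩
    · obtain ⟨V, hV, hxV, hf⟩ := H x hx
      exact hf.2.1 x hxV h
    · obtain ⟨V, hV, hxV, hf⟩ := H p.1 hp.1
      exact ⟨V ×ˢ univ, hV.prod isOpen_univ, ⟨hxV, mem_univ _⟩, hf.2.2⟩

variable {E : Type u} [AddCommGroup E] [Module ℝ E] [TopologicalSpace E]
  [IsTopologicalAddGroup E] [ContinuousSMul ℝ E]
  {E' : Type u} [AddCommGroup E'] [Module ℝ E'] [TopologicalSpace E']
  [IsTopologicalAddGroup E'] [ContinuousSMul ℝ E']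
  {G : Type w} [AddCommGroup G] [Module ℝ G] [TopologicalSpace G] [T2Space G]
  {G' : Type w} [AddCommGroup G'] [Module ℝ G'] [TopologicalSpace G'] [T2Space G']

theorem SmoothMB.clm (A : E →L[ℝ] G) (U : Set E) : SmoothMB (fun x => A x) U :=
  fun n => ContDiffMB.clm n A U

theorem SmoothMB.fst [T2Space E] {U : Set (E × E')} : SmoothMB (fun z : E × E' => z.1) U :=
  SmoothMB.clm (ContinuousLinearMap.fst ℝ E E') U

theorem SmoothMB.snd [T2Space E'] {U : Set (E × E')} : SmoothMB (fun z : E × E' => z.2) U :=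
  SmoothMB.clm (ContinuousLinearMap.snd ℝ E E') U

theorem SmoothMB.zero {U : Set E} : SmoothMB (fun _ : E => (0 : G)) U :=
  SmoothMB.clm (0 : E →L[ℝ] G) U

theorem SmoothMB.mono {f : E → G} {U V : Set E} (h : V ⊆ U) (H : SmoothMB f U) : SmoothMB f V :=
  fun n => (H n).mono h

theorem SmoothMB.congr {f g : E → G} {U : Set E} (hU : IsOpen U) (H : SmoothMB f U)
    (hfg : EqOn f g U) : SmoothMB g U :=
  fun n => (H n).congr hU hfg

theorem SmoothMB.prodMk {f : E → G} {g : E → G'} {U : Set E} (hU : IsOpen U)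
    (H : SmoothMB f U) (H' : SmoothMB g U) : SmoothMB (fun x => (f x, g x)) U :=
  fun n => (H n).prodMk hU (H' n)

theorem SmoothMB.clm_comp (L : G →L[ℝ] G') {f : E → G} {U : Set E} (hU : IsOpen U)
    (H : SmoothMB f U) : SmoothMB (fun x => L (f x)) U :=
  fun n => (H n).clm_comp L hU

theorem SmoothMB.of_locally {f : E → G} {U : Set E}
    (H : ∀ x ∈ U, ∃ V, IsOpen V ∧ x ∈ V ∧ SmoothMB f V) : SmoothMB f U := fun n =>
  ContDiffMB.of_locally fun x hx =>
    let ⟨V, hV, hxV, hf⟩ := H x hx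
    ⟨V, hV, hxV, hf n⟩

variable [IsTopologicalAddGroup G] [ContinuousSMul ℝ G] [LocallyConvexSpace ℝ G]

theorem SmoothMB.comp [T2Space E'] {g : E' → G} {f : E → E'} {U : Set E} {U' : Set E'}
    (hU : IsOpen U) (hU' : IsOpen U') (hg : SmoothMB g U') (hf : SmoothMB f U)
    (hm : MapsTo f U U') : SmoothMB (fun x => g (f x)) U :=
  fun n => (hg n).comp hU hU' (hf n) hm

theorem SmoothMB.sub {f g : E → G} {U : Set E} (hU : IsOpen U)
    (H : SmoothMB f U) (H' : SmoothMB g U) : SmoothMB (fun x => f x - g x) U :=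
  (H.prodMk hU H').clm_comp (ContinuousLinearMap.fst ℝ G G - ContinuousLinearMap.snd ℝ G G) hU

theorem SmoothMB.add {f g : E → G} {U : Set E} (hU : IsOpen U)
    (H : SmoothMB f U) (H' : SmoothMB g U) : SmoothMB (fun x => f x + g x) U :=
  (H.prodMk hU H').clm_comp (ContinuousLinearMap.fst ℝ G G + ContinuousLinearMap.snd ℝ G G) hU

/-- For a `C^1` map, difference quotients converge jointly in the base point and the direction. -/
theorem tendsto_slope_moving {f : E → G} {U : Set E} (hU : IsOpen U)
    (hf : ContDiffMB 1 f U) {x : E} (hx : x ∈ U) (h : E) :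
    Tendsto (fun p : ℝ × E × E => p.1⁻¹ • (f (p.2.1 + p.1 • p.2.2) - f p.2.1))
      (𝓝[≠] 0 ×ˢ 𝓝 (x, h)) (𝓝 (dirDeriv f x h)) := by
  have hD : ContinuousAt (fun p : E × E => dirDeriv f p.1 p.2) (x, h) :=
    ContinuousOn.continuousAt hf.2.2 ((hU.prod isOpen_univ).mem_nhds ⟨hx, mem_univ _⟩)
  intro W hW
  obtain ⟨W', hW', hW'c, hW'W⟩ := exists_mem_nhds_isClosed_subset hW
  obtain ⟨K, ⟨hK, hKc⟩, hKW⟩ :=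
    ((LocallyConvexSpace.convex_basis (𝕜 := ℝ) (dirDeriv f x h)).mem_iff).1 hW'
  have hN : ∀ᶠ p : E × E in 𝓝 (x, h), p.1 ∈ U ∧ dirDeriv f p.1 p.2 ∈ K :=
    ((continuous_fst.tendsto (x, h)).eventually (hU.mem_nhds hx)).and (hD.eventually hK)
  have hm : Continuous (fun q : ℝ × E × E => (q.2.1 + q.1 • q.2.2, q.2.2)) := by fun_prop
  have hm0 := hm.tendsto (0, x, h)
  simp only [zero_smul, add_zero] at hm0
  have h3 := hm0.eventually hN
  rw [nhds_prod_eq, eventually_prod_iff] at h3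
  obtain ⟨pa, hpa, pb, hpb, hab⟩ := h3
  obtain ⟨ε, hε, hball⟩ := Metric.eventually_nhds_iff.1 hpa
  have h4 : ∀ᶠ t : ℝ in 𝓝[≠] 0, |t| < ε ∧ t ≠ 0 := by
    refine Filter.Eventually.and ?_ self_mem_nhdsWithin
    refine nhdsWithin_le_nhds ?_
    filter_upwards [Metric.ball_mem_nhds (0 : ℝ) hε] with t ht
    simpa using ht
  show ∀ᶠ p : ℝ × E × E in 𝓝[≠] 0 ×ˢ 𝓝 (x, h), _ ∈ W
  rw [eventually_prod_iff]
  refine ⟨_, h4, pb, hpb, ?_⟩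
  intro t ht k hk
  -- Along the whole segment the derivative stays in the convex set `K`, so the mean value estimate
  -- puts the quotient in the closure of `K`, which lies in the closed set `W'`.
  refine hW'W (closure_minimal hKW hW'c ?_)
  refine slope_mem ht.2 hKc.closure isClosed_closure fun s hs => ?_
  have hs' : |s| < ε := by
    have := Set.abs_sub_left_of_mem_uIcc hs
    simp only [sub_zero] at this
    exact this.trans_lt ht.1
  have h5 := hab (x := s) (hball (by simpa using hs')) hk
  exact ⟨_, subset_closure h5.2, hasDirDeriv_dirDeriv (hf.2.1 _ h5.1 k.2)⟩

/-- The increment of `f` along `t(h + k)` is split at `x + t h`. The second piece has a base point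
that moves with `t`, so convergence at a fixed base point would not suffice; `tendsto_slope_moving`
supplies what is needed. -/
theorem dirDeriv_add {f : E → G} {U : Set E} (hU : IsOpen U)
    (hf : ContDiffMB 1 f U) {x : E} (hx : x ∈ U) (h k : E) :
    dirDeriv f x (h + k) = dirDeriv f x h + dirDeriv f x k := by
  have h1 : Tendsto (fun t : ℝ => (t, x + t • h, k)) (𝓝[≠] 0) (𝓝[≠] 0 ×ˢ 𝓝 (x, k)) :=
    tendsto_id.prodMk ((line_tendsto x h).prodMk_nhds tendsto_const_nhds)
  have h2 := (hasDirDeriv_dirDeriv (hf.2.1 x hx h)).add ((tendsto_slope_moving hU hf hx k).comp h1)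
  refine HasDirDeriv.eq (h2.congr fun t => ?_)
  simp only [Function.comp_apply, ← smul_add, add_assoc]
  congr 1
  abel

theorem dirDeriv_smul {f : E → G} {U : Set E} (hU : IsOpen U)
    (hf : ContDiffMB 1 f U) {x : E} (hx : x ∈ U) (a : ℝ) (h : E) :
    dirDeriv f x (a • h) = a • dirDeriv f x h := by
  rcases eq_or_ne a 0 with rfl | ha
  · simp only [zero_smul]
    -- Additivity applied to `0 + 0` forces the derivative in the direction `0` to vanish.
    have := dirDeriv_add hU hf hx 0 0
    simpa using this
  · refine HasDirDeriv.eq ?_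
    have h0 : Tendsto (fun t : ℝ => t * a) (𝓝[≠] 0) (𝓝[≠] 0) := by
      refine tendsto_nhdsWithin_of_tendsto_nhds_of_eventually_within _ ?_ ?_
      · have : Tendsto (fun t : ℝ => t * a) (𝓝 0) (𝓝 (0 * a)) :=
          (continuous_mul_const a).tendsto 0
        rw [zero_mul] at this
        exact this.mono_left nhdsWithin_le_nhds
      · filter_upwards [self_mem_nhdsWithin] with t ht
        exact mul_ne_zero ht ha
    have h1 := (Tendsto.comp (hasDirDeriv_dirDeriv (hf.2.1 x hx h)) h0).const_smul a
    refine h1.congr fun t => ?_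
    simp only [Function.comp_apply, smul_smul, mul_inv]
    congr 1
    field_simp

theorem isLinearMap_dirDeriv {f : E → G} {U : Set E} (hU : IsOpen U)
    (hf : SmoothMB f U) {x : E} (hx : x ∈ U) : IsLinearMap ℝ (dirDeriv f x) :=
  ⟨dirDeriv_add hU (hf 1) hx, dirDeriv_smul hU (hf 1) hx⟩

end Calculus

/-! ### Vector-valued functions on manifolds and their derivatives along tangent vectors -/

section Along

variable {E : Type u} [AddCommGroup E] [Module ℝ E] [TopologicalSpace E]
  {M : Type v} [TopologicalSpace M] [ChartedSpace E M]
  {G : Type u} [AddCommGroup G] [Module ℝ G] [TopologicalSpace G]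
  {G' : Type u} [AddCommGroup G'] [Module ℝ G'] [TopologicalSpace G']

variable (E) in
/-- The vector-valued function `f` is smooth on the set `W`. -/
def SmoothFunOn (f : M → G) (W : Set M) : Prop :=
  ∀ e ∈ atlas E M, SmoothMB (fun y => f (e.symm y)) (e.target ∩ e.symm ⁻¹' W)

/-- The derivative of the vector-valued function `f` along the tangent vector `ξ`. -/
noncomputable def along (f : M → G) (ξ : TangentBdl E M) : G :=
  dirDeriv (fun y => f ((chartAt E ξ.pt).symm y)) (chartAt E ξ.pt ξ.pt) ξ.vec

/-- A diffeomorphism of an open subset of a manifold onto an open subset of a vector space. -/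
structure IsSmoothChart (Φ : OpenPartialHomeomorph M G) : Prop where
  smooth : SmoothFunOn E (fun x => Φ x) Φ.source
  smooth_symm : ∀ c ∈ atlas E M, SmoothMB (fun y => c (Φ.symm y)) (Φ.symm.trans c).source

variable [IsTopologicalAddGroup E] [ContinuousSMul ℝ E] [LocallyConvexSpace ℝ E] [T2Space E]
  [IsTopologicalAddGroup G] [ContinuousSMul ℝ G] [LocallyConvexSpace ℝ G] [T2Space G]
  [IsTopologicalAddGroup G'] [ContinuousSMul ℝ G'] [LocallyConvexSpace ℝ G'] [T2Space G']

theorem SmoothFunOn.mono {f : M → G} {W W' : Set M} (h : W' ⊆ W) (H : SmoothFunOn E f W) :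
    SmoothFunOn E f W' := fun e he =>
  (H e he).mono (inter_subset_inter_right _ (preimage_mono h))

theorem isOpen_chart_preimage (e : OpenPartialHomeomorph M E) {W : Set M} (hW : IsOpen W) :
    IsOpen (e.target ∩ e.symm ⁻¹' W) :=
  e.isOpen_inter_preimage_symm hW

theorem mem_chartAt_preimage {x : M} {W : Set M} (hx : x ∈ W) :
    chartAt E x x ∈ (chartAt E x).target ∩ (chartAt E x).symm ⁻¹' W :=
  ⟨mem_chart_target E x, by simpa using hx⟩

theorem SmoothFunOn.congr {f g : M → G} {W : Set M} (hW : IsOpen W) (H : SmoothFunOn E f W)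
    (hfg : EqOn f g W) : SmoothFunOn E g W := fun e he =>
  (H e he).congr (isOpen_chart_preimage e hW) fun _ hy => hfg hy.2

theorem along_congr {f g : M → G} {W : Set M} (hW : IsOpen W) (hfg : EqOn f g W)
    {ξ : TangentBdl E M} (hξ : ξ.pt ∈ W) : along f ξ = along g ξ :=
  dirDeriv_congr (isOpen_chart_preimage _ hW) (fun _ hy => hfg hy.2) (mem_chartAt_preimage hξ) _

theorem SmoothFunOn.hasDirDeriv {f : M → G} {W : Set M}
    (H : SmoothFunOn E f W) {ξ : TangentBdl E M} (hξ : ξ.pt ∈ W) :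
    HasDirDeriv (fun y => f ((chartAt E ξ.pt).symm y)) (chartAt E ξ.pt ξ.pt) ξ.vec (along f ξ) :=
  (H _ (chart_mem_atlas E _)).hasDirDeriv (mem_chartAt_preimage hξ) _

theorem SmoothFunOn.comp {f : M → G} {W : Set M} {g : G → G'} {U : Set G} (hW : IsOpen W)
    (hU : IsOpen U) (hg : SmoothMB g U) (hf : SmoothFunOn E f W) (hm : MapsTo f W U) :
    SmoothFunOn E (fun x => g (f x)) W := fun e he =>
  hg.comp (isOpen_chart_preimage e hW) hU (hf e he) fun _ hy => hm hy.2

theorem along_comp {f : M → G} {W : Set M} {g : G → G'} {U : Set G}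
    (hU : IsOpen U) (hg : SmoothMB g U) (hf : SmoothFunOn E f W) {ξ : TangentBdl E M}
    (hξ : ξ.pt ∈ W) (hm : f ξ.pt ∈ U) :
    along (fun x => g (f x)) ξ = dirDeriv g (f ξ.pt) (along f ξ) := by
  have h := (hf.hasDirDeriv hξ).comp hU (hg 1) (by simpa using hm)
  simpa [along] using h.eq

theorem along_clm (L : G →L[ℝ] G') {f : M → G} {W : Set M}
    (hf : SmoothFunOn E f W) {ξ : TangentBdl E M} (hξ : ξ.pt ∈ W) :
    along (fun x => L (f x)) ξ = L (along f ξ) :=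
  ((hf.hasDirDeriv hξ).clm_comp L).eq

theorem along_prodMk {f : M → G} {g : M → G'} {W : Set M}
    (hf : SmoothFunOn E f W) (hg : SmoothFunOn E g W) {ξ : TangentBdl E M} (hξ : ξ.pt ∈ W) :
    along (fun x => (f x, g x)) ξ = (along f ξ, along g ξ) :=
  ((hf.hasDirDeriv hξ).prodMk (hg.hasDirDeriv hξ)).eq

theorem along_const (a : G) (ξ : TangentBdl E M) : along (fun _ : M => a) ξ = 0 := by
  refine HasDirDeriv.eq (Tendsto.congr (f₁ := fun _ => 0) (fun t => ?_) tendsto_const_nhds)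
  simp

theorem isLinearMap_along {f : M → G'} {W : Set M} (hW : IsOpen W) (hf : SmoothFunOn E f W)
    {x : M} (hx : x ∈ W) : IsLinearMap ℝ (fun z : E => along f (⟨x, z⟩ : TangentBdl E M)) := by
  have h : IsLinearMap ℝ (dirDeriv (fun y => f ((chartAt E x).symm y)) (chartAt E x x)) :=
    isLinearMap_dirDeriv (isOpen_chart_preimage (chartAt E x) hW) (hf _ (chart_mem_atlas E x))
      (mem_chartAt_preimage hx)
  exact ⟨h.1, h.2⟩

/-- The derivative of `f` computed in an arbitrary smooth chart. -/
theorem SmoothFunOn.smooth_symm {f : M → G'} {W : Set M} (hW : IsOpen W)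
    (hf : SmoothFunOn E f W) {Φ : OpenPartialHomeomorph M G} (hΦ : IsSmoothChart (E := E) Φ) :
    SmoothMB (fun y => f (Φ.symm y)) (Φ.target ∩ Φ.symm ⁻¹' W) := by
  refine SmoothMB.of_locally fun y hy => ?_
  set c := chartAt E (Φ.symm y)
  -- Near `y` the map is factored through the atlas chart `c`, since smoothness of `f` and of
  -- `Φ.symm` is only given relative to the atlas.
  have ho : IsOpen ((Φ.symm.trans c).source ∩ (Φ.target ∩ Φ.symm ⁻¹' W)) :=
    (Φ.symm.trans c).open_source.inter (Φ.isOpen_inter_preimage_symm hW)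
  refine ⟨_, ho, ⟨⟨hy.1, mem_chart_source E _⟩, hy⟩, ?_⟩
  have h1 : SmoothMB (fun z => c (Φ.symm z)) _ :=
    (hΦ.smooth_symm c (chart_mem_atlas E _)).mono (inter_subset_left (t := Φ.target ∩ Φ.symm ⁻¹' W))
  refine ((hf c (chart_mem_atlas E _)).comp ho (isOpen_chart_preimage c hW) h1
    fun z hz => ⟨c.map_source hz.1.2, ?_⟩).congr ho fun z hz => ?_
  · change c.symm (c (Φ.symm z)) ∈ W
    have hz' : c.symm (c (Φ.symm z)) = Φ.symm z := c.left_inv hz.1.2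
    rw [hz']
    exact hz.2.2
  · exact congrArg f (c.left_inv hz.1.2)

/-- Near the base point `f = (f ∘ Φ⁻¹) ∘ Φ`, so this is the chain rule. It frees computations from
the preferred chart used to define `along`, in particular for bundle charts, which need not belong
to the atlas. -/
theorem along_eq_dirDeriv {f : M → G'} {W : Set M} (hW : IsOpen W) (hf : SmoothFunOn E f W)
    {Φ : OpenPartialHomeomorph M G} (hΦ : IsSmoothChart (E := E) Φ) {ξ : TangentBdl E M}
    (hξ : ξ.pt ∈ W) (hξ' : ξ.pt ∈ Φ.source) :
    along f ξ = dirDeriv (fun y => f (Φ.symm y)) (Φ ξ.pt) (along Φ ξ) := by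
  have hU : IsOpen (Φ.target ∩ Φ.symm ⁻¹' W) := Φ.isOpen_inter_preimage_symm hW
  rw [← along_comp hU (hf.smooth_symm hW hΦ) hΦ.smooth hξ'
    ⟨Φ.map_source hξ', by simpa [Φ.left_inv hξ'] using hξ⟩]
  exact along_congr Φ.open_source (fun x hx => by simp [Φ.left_inv hx]) hξ'

end Along

/-! ### Smooth maps between manifolds, tangent maps and tangent charts -/

section Manifold

variable {E : Type u} [AddCommGroup E] [Module ℝ E] [TopologicalSpace E]
  [IsTopologicalAddGroup E] [ContinuousSMul ℝ E] [LocallyConvexSpace ℝ E] [T2Space E]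
  {M : Type v} [TopologicalSpace M] [ChartedSpace E M] [SmoothManifold E M]
  {E' : Type u} [AddCommGroup E'] [Module ℝ E'] [TopologicalSpace E']
  [IsTopologicalAddGroup E'] [ContinuousSMul ℝ E'] [LocallyConvexSpace ℝ E'] [T2Space E']
  {N : Type w} [TopologicalSpace N] [ChartedSpace E' N] [SmoothManifold E' N]
  {E'' : Type u} [AddCommGroup E''] [Module ℝ E''] [TopologicalSpace E'']
  [IsTopologicalAddGroup E''] [ContinuousSMul ℝ E''] [LocallyConvexSpace ℝ E''] [T2Space E'']
  {P : Type*} [TopologicalSpace P] [ChartedSpace E'' P] [SmoothManifold E'' P]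
  {G : Type u} [AddCommGroup G] [Module ℝ G] [TopologicalSpace G]
  [IsTopologicalAddGroup G] [ContinuousSMul ℝ G] [LocallyConvexSpace ℝ G] [T2Space G]

theorem isSmoothChart_of_mem_atlas {e : OpenPartialHomeomorph M E} (he : e ∈ atlas E M) :
    IsSmoothChart (E := E) e :=
  ⟨fun _ hc => smooth_chart hc he, fun _ hc => smooth_chart he hc⟩

theorem along_chartAt (ξ : TangentBdl E M) : along (chartAt E ξ.pt) ξ = ξ.vec :=
  chartChange_self _ (mem_chart_target E _) _

/-- Smoothness of a function may be tested on a family of atlas charts. -/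
theorem SmoothFunOn.of_charts {f : M → G} {W : Set M}
    (H : ∀ x ∈ W, ∃ e ∈ atlas E M, ∃ U ⊆ e.target, IsOpen U ∧ x ∈ e.source ∧ e x ∈ U ∧
      SmoothMB (fun y => f (e.symm y)) U) : SmoothFunOn E f W := by
  refine fun c hc => SmoothMB.of_locally fun y hy => ?_
  obtain ⟨e, he, U, hUe, hU, hxe, hxU, hf⟩ := H _ hy.2
  have ho : IsOpen ((c.symm.trans e).source ∩ (c.symm.trans e) ⁻¹' U) :=
    (c.symm.trans e).isOpen_inter_preimage hU
  refine ⟨_, ho, ⟨⟨hy.1, hxe⟩, hxU⟩, ?_⟩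
  refine (hf.comp ho hU ((smooth_chart hc he).mono inter_subset_left)
    fun z hz => hz.2).congr ho fun z hz => ?_
  exact congrArg f (e.left_inv hz.1.2)

theorem SmoothFunOn.continuousOn {f : M → G} {W : Set M} (hW : IsOpen W)
    (H : SmoothFunOn E f W) : ContinuousOn f W := by
  intro x hx
  refine ContinuousAt.continuousWithinAt ?_
  set c := chartAt E x
  have h1 : ContinuousAt (fun y => f (c.symm y)) (c x) :=
    (H c (chart_mem_atlas E x)).continuousOn.continuousAt
      ((isOpen_chart_preimage c hW).mem_nhds (mem_chartAt_preimage hx))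
  have h2 : ContinuousAt (fun z => f (c.symm (c z))) x :=
    ContinuousAt.comp (f := c) h1 (c.continuousAt (mem_chart_source E x))
  refine h2.congr ?_
  filter_upwards [c.open_source.mem_nhds (mem_chart_source E x)] with z hz
  rw [c.left_inv hz]

/-- Locally `f ∘ φ ∘ e⁻¹` factors as `(f ∘ c⁻¹) ∘ (c ∘ φ ∘ e⁻¹)` for a chart `c` around the image
point. -/
theorem MSmooth.smoothFunOn {φ : M → N} (h : MSmooth E E' φ) {f : N → G} {W : Set N}
    (hW : IsOpen W) (hf : SmoothFunOn E' f W) : SmoothFunOn E (fun x => f (φ x)) (φ ⁻¹' W) := by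
  intro e he
  refine SmoothMB.of_locally fun y hy => ?_
  set c := chartAt E' (φ (e.symm y))
  have ho : IsOpen (e.target ∩ e.symm ⁻¹' (φ ⁻¹' (c.source ∩ W))) :=
    isOpen_chart_preimage e ((c.open_source.inter hW).preimage h.1)
  refine ⟨_, ho, ⟨hy.1, mem_chart_source E' _, hy.2⟩, ?_⟩
  have h1 : SmoothMB (fun z => c (φ (e.symm z))) (e.target ∩ e.symm ⁻¹' (φ ⁻¹' (c.source ∩ W))) :=
    (h.2 e he c (chart_mem_atlas E' _)).mono
      (inter_subset_inter_right _ (preimage_mono (preimage_mono inter_subset_left)))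
  have hm : MapsTo (fun z => c (φ (e.symm z))) (e.target ∩ e.symm ⁻¹' (φ ⁻¹' (c.source ∩ W)))
      (c.target ∩ c.symm ⁻¹' W) := by
    refine fun z hz => ⟨c.map_source hz.2.1, ?_⟩
    change c.symm (c (φ (e.symm z))) ∈ W
    rw [c.left_inv hz.2.1]
    exact hz.2.2
  refine ((hf c (chart_mem_atlas E' _)).comp ho (isOpen_chart_preimage c hW) h1 hm).congr ho
    fun z hz => ?_
  exact congrArg f (c.left_inv hz.2.1)

theorem MSmooth.chart {φ : M → N} (h : MSmooth E E' φ) {Φ : OpenPartialHomeomorph N G}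
    (hΦ : IsSmoothChart (E := E') Φ) : SmoothFunOn E (fun x => Φ (φ x)) (φ ⁻¹' Φ.source) :=
  h.smoothFunOn Φ.open_source hΦ.smooth

/-- Smoothness of a map may be tested in charts of the target around each point. -/
theorem MSmooth.of_charts {φ : M → N}
    (H : ∀ x : M, ∃ c ∈ atlas E' N, ∃ W, IsOpen W ∧ x ∈ W ∧ MapsTo φ W c.source ∧
      SmoothFunOn E (fun x => c (φ x)) W) : MSmooth E E' φ := by
  have hc : Continuous φ := by
    refine continuous_iff_continuousAt.2 fun x => ?_
    obtain ⟨c, hc, W, hW, hxW, hm, hf⟩ := H x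
    have h1 : ContinuousAt (fun z => c.symm (c (φ z))) x :=
      ContinuousAt.comp (f := fun z => c (φ z)) (g := c.symm)
        (c.continuousAt_symm (c.map_source (hm hxW))) ((hf.continuousOn hW).continuousAt (hW.mem_nhds hxW))
    refine h1.congr ?_
    filter_upwards [hW.mem_nhds hxW] with z hz
    rw [c.left_inv (hm hz)]
  refine ⟨hc, fun e he e' he' => ?_⟩
  refine SmoothMB.of_locally fun y hy => ?_
  obtain ⟨c, hc', W, hW, hxW, hm, hf⟩ := H (e.symm y)
  have ho : IsOpen (e.target ∩ e.symm ⁻¹' (W ∩ φ ⁻¹' e'.source)) :=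
    isOpen_chart_preimage e (hW.inter (e'.open_source.preimage hc))
  refine ⟨_, ho, ⟨hy.1, hxW, hy.2⟩, ?_⟩
  have h1 : SmoothMB (fun z => c (φ (e.symm z))) (e.target ∩ e.symm ⁻¹' (W ∩ φ ⁻¹' e'.source)) :=
    (hf e he).mono (inter_subset_inter_right _ (preimage_mono inter_subset_left))
  have h2 : MapsTo (fun z => c (φ (e.symm z))) (e.target ∩ e.symm ⁻¹' (W ∩ φ ⁻¹' e'.source))
      (c.symm.trans e').source := by
    refine fun z hz => ⟨c.map_source (hm hz.2.1), ?_⟩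
    change c.symm (c (φ (e.symm z))) ∈ e'.source
    rw [c.left_inv (hm hz.2.1)]
    exact hz.2.2
  refine ((smooth_chart hc' he').comp ho (isOpen_change c e') h1 h2).congr ho fun z hz => ?_
  exact congrArg e' (c.left_inv (hm hz.2.1))

theorem MSmooth.id : MSmooth E E (fun x : M => x) :=
  MSmooth.of_charts fun x => ⟨chartAt E x, chart_mem_atlas E x, _, (chartAt E x).open_source,
    mem_chart_source E x, fun _ h => h, (isSmoothChart_of_mem_atlas (chart_mem_atlas E x)).smooth⟩

theorem MSmooth.comp {ψ : N → P} {φ : M → N} (hψ : MSmooth E' E'' ψ) (hφ : MSmooth E E' φ) :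
    MSmooth E E'' (fun x => ψ (φ x)) :=
  MSmooth.of_charts fun x => ⟨chartAt E'' (ψ (φ x)), chart_mem_atlas E'' _, _,
    (chartAt E'' (ψ (φ x))).open_source.preimage (hψ.1.comp hφ.1), mem_chart_source E'' _,
    fun _ h => h, hφ.smoothFunOn ((chartAt E'' (ψ (φ x))).open_source.preimage hψ.1)
      (hψ.chart (isSmoothChart_of_mem_atlas (chart_mem_atlas E'' _)))⟩

/-- Chain rule. -/
theorem along_tangentMap {φ : M → N} (hφ : MSmooth E E' φ) {f : N → G} {W : Set N}
    (hW : IsOpen W) (hf : SmoothFunOn E' f W) {ξ : TangentBdl E M} (hξ : φ ξ.pt ∈ W) :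
    along f (tangentMap E E' φ ξ) = along (fun x => f (φ x)) ξ := by
  set c := chartAt E' (φ ξ.pt)
  have hc := isSmoothChart_of_mem_atlas (chart_mem_atlas E' (φ ξ.pt))
  have hs : φ ξ.pt ∈ c.source := mem_chart_source E' _
  have h1 := along_comp (f := fun x => c (φ x)) (isOpen_chart_preimage c hW)
    (hf c (chart_mem_atlas E' _)) (hφ.chart hc) hs (ξ := ξ) (mem_chartAt_preimage hξ)
  have h2 : along (fun x => f (c.symm (c (φ x)))) ξ = along (fun x => f (φ x)) ξ :=
    along_congr (c.open_source.preimage hφ.1) (fun x hx => by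
      exact congrArg f (c.left_inv hx)) hs
  exact h1.symm.trans h2

/-- The principal part is recovered from the coordinates in `Φ` by applying the derivative of the
change from `Φ` to the preferred chart. -/
theorem TangentBdl.ext_along {Φ : OpenPartialHomeomorph M G} (hΦ : IsSmoothChart (E := E) Φ)
    {ξ η : TangentBdl E M} (h : ξ.pt = η.pt) (hξ : ξ.pt ∈ Φ.source)
    (ha : along Φ ξ = along Φ η) : ξ = η := by
  rcases ξ with ⟨x, v⟩
  rcases η with ⟨y, w⟩
  obtain rfl : x = y := h
  refine TangentBdl.ext rfl ?_
  have hc := (isSmoothChart_of_mem_atlas (chart_mem_atlas E x)).smooth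
  have key (v : E) : v = dirDeriv (fun y => chartAt E x (Φ.symm y)) (Φ x)
      (along Φ (⟨x, v⟩ : TangentBdl E M)) :=
    (along_chartAt (⟨x, v⟩ : TangentBdl E M)).symm.trans
      (along_eq_dirDeriv (chartAt E x).open_source hc hΦ (mem_chart_source E x) hξ)
  exact (key v).trans ((congrArg _ ha).trans (key w).symm)

/-- Every vector is the coordinate vector of a tangent vector. -/
theorem exists_along_eq {Φ : OpenPartialHomeomorph M G} (hΦ : IsSmoothChart (E := E) Φ) {x : M}
    (hx : x ∈ Φ.source) (z : G) : ∃ v : E, along Φ (⟨x, v⟩ : TangentBdl E M) = z := by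
  set c := chartAt E x
  -- The witness carries `z` back to the preferred chart; differentiating `Φ ∘ c⁻¹ ∘ c ∘ Φ⁻¹ = id`
  -- shows that it has the required coordinates.
  refine ⟨dirDeriv (fun y => c (Φ.symm y)) (Φ x) z, ?_⟩
  have h1 : HasDirDeriv (fun y => c (Φ.symm y)) (Φ x) z _ :=
    (hΦ.smooth_symm c (chart_mem_atlas E x)).hasDirDeriv
      ⟨Φ.map_source hx, by simp [Φ.left_inv hx, c]⟩ z
  have h2 := h1.comp (c.isOpen_inter_preimage_symm Φ.open_source)
    (hΦ.smooth c (chart_mem_atlas E x) 1) (by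
      rw [Φ.left_inv hx]
      exact mem_chartAt_preimage hx)
  have h3 : HasDirDeriv (fun y => Φ (c.symm (c (Φ.symm y)))) (Φ x) z z :=
    (hasDirDeriv_id (Φ x) z).congr (Φ.symm.trans c).open_source (fun y hy => by
      have hy' : c.symm (c (Φ.symm y)) = Φ.symm y := c.left_inv hy.2
      rw [hy']
      exact (Φ.right_inv hy.1).symm)
      ⟨Φ.map_source hx, by simp [Φ.left_inv hx, c]⟩
  have h4 := h2.eq.symm.trans h3.eq
  rw [Φ.left_inv hx] at h4
  exact h4

theorem tangentMap_comp {ψ : N → P} {φ : M → N} (hψ : MSmooth E' E'' ψ) (hφ : MSmooth E E' φ)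
    (ξ : TangentBdl E M) :
    tangentMap E' E'' ψ (tangentMap E E' φ ξ) = tangentMap E E'' (fun x => ψ (φ x)) ξ :=
  TangentBdl.ext rfl (along_tangentMap hφ ((chartAt E'' (ψ (φ ξ.pt))).open_source.preimage hψ.1)
    (hψ.chart (isSmoothChart_of_mem_atlas (chart_mem_atlas E'' _))) (mem_chart_source E'' _))

theorem tangentMap_id (ξ : TangentBdl E M) : tangentMap E E (fun x : M => x) ξ = ξ :=
  TangentBdl.ext rfl (along_chartAt ξ)

theorem isLinearMap_tangentMap {φ : M → N} (hφ : MSmooth E E' φ) (x : M) :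
    IsLinearMap ℝ (fun z : E => (tangentMap E E' φ ⟨x, z⟩).vec) :=
  isLinearMap_along ((chartAt E' (φ x)).open_source.preimage hφ.1)
    (hφ.chart (isSmoothChart_of_mem_atlas (chart_mem_atlas E' _))) (mem_chart_source E' _)

theorem tangentHomeo_apply (e : atlas E M) (p : TangentBdl E M) :
    tangentHomeo e p = (e.1 p.pt, along e.1 p) := rfl

theorem tangentHomeo_symm_pt (e : atlas E M) (z : E × E) :
    ((tangentHomeo e).symm z).pt = e.1.symm z.1 := rfl

theorem along_tangentHomeo_symm (e : atlas E M) {z : E × E} (hz : z.1 ∈ e.1.target) :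
    along e.1 ((tangentHomeo e).symm z) = z.2 :=
  congrArg Prod.snd ((tangentHomeo e).right_inv (show z ∈ (tangentHomeo e).target from
    ⟨hz, mem_univ _⟩))

theorem isSmoothChart_tangentHomeo (e : atlas E M) :
    IsSmoothChart (E := E × E) (tangentHomeo e) :=
  isSmoothChart_of_mem_atlas (mem_atlas_tangent.2 ⟨e, rfl⟩)

theorem MSmooth.pt : MSmooth (E × E) E (fun p : TangentBdl E M => p.pt) := by
  refine MSmooth.of_charts fun p => ?_
  set e : atlas E M := ⟨chartAt E p.pt, chart_mem_atlas E p.pt⟩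
  refine ⟨e.1, e.2, _, (tangentHomeo e).open_source, mem_chart_source E p.pt, fun _ h => h, ?_⟩
  have h : SmoothMB (fun z : E × E => z.1) univ := SmoothMB.fst
  exact (isSmoothChart_tangentHomeo e).smooth.comp (tangentHomeo e).open_source isOpen_univ h
    (mapsTo_univ _ _)

/-- The derivative `p ↦ D f (p)` of a smooth function is a smooth function on the tangent
bundle. -/
theorem SmoothFunOn.along {f : M → G} {W : Set M} (hW : IsOpen W) (hf : SmoothFunOn E f W) :
    SmoothFunOn (E × E) (fun p : TangentBdl E M => along f p) {p | p.pt ∈ W} := by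
  refine SmoothFunOn.of_charts fun p hp => ?_
  set e : atlas E M := ⟨chartAt E p.pt, chart_mem_atlas E p.pt⟩
  have ho : IsOpen ((e.1.target ∩ e.1.symm ⁻¹' W) ×ˢ (univ : Set E)) :=
    (isOpen_chart_preimage e.1 hW).prod isOpen_univ
  refine ⟨tangentHomeo e, mem_atlas_tangent.2 ⟨e, rfl⟩, _, fun z hz => ⟨hz.1.1, mem_univ _⟩, ho,
    mem_chart_source E p.pt, ⟨mem_chartAt_preimage hp, mem_univ _⟩, ?_⟩
  -- In the chart of `TM` induced by `e` the function becomes `(y, v) ↦ D(f ∘ e⁻¹)(y)(v)`, smooth by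
  -- definition of the calculus.
  refine (hf e.1 e.2).dirDeriv.congr ho fun z hz => ?_
  rw [along_eq_dirDeriv hW hf (isSmoothChart_of_mem_atlas e.2) (ξ := (tangentHomeo e).symm z)
    hz.1.2 (e.1.map_target hz.1.1), along_tangentHomeo_symm e hz.1.1, tangentHomeo_symm_pt,
    e.1.right_inv hz.1.1]

theorem SmoothFunOn.prodMk {E₂ : Type u} [AddCommGroup E₂] [Module ℝ E₂] [TopologicalSpace E₂]
    [T2Space E₂] {f : M → G} {g : M → E₂} {W : Set M} (hW : IsOpen W) (hf : SmoothFunOn E f W)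
    (hg : SmoothFunOn E g W) : SmoothFunOn E (fun x => (f x, g x)) W := fun e he =>
  (hf e he).prodMk (isOpen_chart_preimage e hW) (hg e he)

/-- In the induced charts the map is the pair of `e ∘ φ` and the derivative of `e ∘ φ`, both smooth
functions on `TM`. -/
theorem MSmooth.tangentMap {φ : M → N} (hφ : MSmooth E E' φ) :
    MSmooth (E × E) (E' × E') (tangentMap E E' φ) := by
  refine MSmooth.of_charts fun p => ?_
  set e : atlas E' N := ⟨chartAt E' (φ p.pt), chart_mem_atlas E' _⟩
  have he := isSmoothChart_of_mem_atlas e.2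
  have hW : IsOpen (φ ⁻¹' e.1.source) := e.1.open_source.preimage hφ.1
  have hW' : IsOpen {q : TangentBdl E M | q.pt ∈ φ ⁻¹' e.1.source} :=
    hW.preimage MSmooth.pt.1
  refine ⟨tangentHomeo e, mem_atlas_tangent.2 ⟨e, rfl⟩, _, hW', mem_chart_source E' _,
    fun _ h => h, ?_⟩
  refine (((MSmooth.pt.smoothFunOn hW (hφ.chart he)).prodMk hW'
    ((hφ.chart he).along hW))).congr hW' fun q hq => ?_
  exact congrArg (Prod.mk _) (along_tangentMap hφ e.1.open_source he.smooth hq).symm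

end Manifold

/-! ### Bundle charts and bundle maps -/

section Bundle

/-- The derivative of a map which is linear in its second argument is linear on the pairs of a
vector in the second factor and its increment. -/
theorem dirDeriv_comb_of_linear {F : Type u} [AddCommGroup F] [Module ℝ F] [TopologicalSpace F]
    [IsTopologicalAddGroup F] [ContinuousSMul ℝ F]
    {G : Type u} [AddCommGroup G] [Module ℝ G] [TopologicalSpace G]
    [IsTopologicalAddGroup G] [ContinuousSMul ℝ G]
    {G' : Type u} [AddCommGroup G'] [Module ℝ G'] [TopologicalSpace G']
    [IsTopologicalAddGroup G'] [ContinuousSMul ℝ G'] [T2Space G']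
    {ψ : F × G → G'} {U : Set F} (hU : IsOpen U) (hψ : SmoothMB ψ (U ×ˢ univ))
    (hlin : ∀ y ∈ U, IsLinearMap ℝ (fun g => ψ (y, g))) {y : F} (hy : y ∈ U) (a b : ℝ)
    (g g' : G) (u : F) (k k' : G) :
    dirDeriv ψ (y, a • g + b • g') (u, a • k + b • k') =
      a • dirDeriv ψ (y, g) (u, k) + b • dirDeriv ψ (y, g') (u, k') := by
  have h1 : HasDirDeriv ψ (y, g) (u, k) _ := hψ.hasDirDeriv ⟨hy, mem_univ _⟩ _
  have h2 : HasDirDeriv ψ (y, g') (u, k') _ := hψ.hasDirDeriv ⟨hy, mem_univ _⟩ _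
  refine HasDirDeriv.eq (((h1.const_smul a).add (h2.const_smul b)).congr' ?_)
  have hcomb (y : F) (hy : y ∈ U) (g g' : G) :
      ψ (y, a • g + b • g') = a • ψ (y, g) + b • ψ (y, g') := by
    have := (hlin y hy).map_add (a • g) (b • g')
    simp only [(hlin y hy).map_smul] at this
    exact this
  filter_upwards [(line_tendsto y u).eventually (hU.mem_nhds hy)] with t ht
  have h3 : (y, a • g + b • g') + t • (u, a • k + b • k') =
      (y + t • u, a • (g + t • k) + b • (g' + t • k')) := by
    refine Prod.ext rfl ?_
    simp only [Prod.snd_add, Prod.smul_snd, smul_add, smul_comm t a, smul_comm t b]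
    abel
  rw [h3, hcomb _ ht, hcomb _ hy]
  simp only [Prod.mk_add_mk, Prod.smul_mk, smul_sub, smul_add, smul_comm t⁻¹ a, smul_comm t⁻¹ b]
  abel

/-- In a bundle chart the curve `t ↦ p + t q` is such an affine line; this is its velocity. -/
theorem hasDirDeriv_affine {F : Type*} [AddCommGroup F] [Module ℝ F] [TopologicalSpace F]
    {G : Type*} [AddCommGroup G] [Module ℝ G] [TopologicalSpace G] (y : F) (g k : G) :
    HasDirDeriv (fun t : ℝ => (y, g + t • k)) 0 1 ((0 : F), k) := by
  refine tendsto_const_nhds.congr' ?_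
  filter_upwards [self_mem_nhdsWithin] with t ht
  simp [inv_smul_smul₀ (show t ≠ 0 from ht)]

namespace VectorFibration

variable {F : Type u} [AddCommGroup F] [Module ℝ F] [TopologicalSpace F]
  [IsTopologicalAddGroup F] [ContinuousSMul ℝ F] [LocallyConvexSpace ℝ F] [T2Space F]
  {G : Type u} [AddCommGroup G] [Module ℝ G] [TopologicalSpace G]
  [IsTopologicalAddGroup G] [ContinuousSMul ℝ G] [LocallyConvexSpace ℝ G] [T2Space G]
  {G' : Type u} [AddCommGroup G'] [Module ℝ G'] [TopologicalSpace G']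
  [IsTopologicalAddGroup G'] [ContinuousSMul ℝ G'] [LocallyConvexSpace ℝ G'] [T2Space G']
  {H : Type u} [AddCommGroup H] [Module ℝ H] [TopologicalSpace H]
  [IsTopologicalAddGroup H] [ContinuousSMul ℝ H] [LocallyConvexSpace ℝ H] [T2Space H]
  {H' : Type u} [AddCommGroup H'] [Module ℝ H'] [TopologicalSpace H']
  [IsTopologicalAddGroup H'] [ContinuousSMul ℝ H'] [LocallyConvexSpace ℝ H'] [T2Space H']
  {M : Type v} [TopologicalSpace M] [ChartedSpace F M] [SmoothManifold F M]
  {V : Type w} [TopologicalSpace V] [ChartedSpace H V] [SmoothManifold H V]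
  {V' : Type w} [TopologicalSpace V'] [ChartedSpace H' V'] [SmoothManifold H' V']
  {B : VectorFibration M V} {B' : VectorFibration M V'}
  {e : OpenPartialHomeomorph M F} {Φ : OpenPartialHomeomorph V (F × G)}
  {e' : OpenPartialHomeomorph M F} {Ψ : OpenPartialHomeomorph V' (F × G')}

theorem IsBundleChart.isSmoothChart (h : B.IsBundleChart F G H e Φ) :
    IsSmoothChart (E := H) Φ :=
  ⟨h.smooth, h.smooth_symm⟩

theorem IsBundleChart.mem_source (h : B.IsBundleChart F G H e Φ) {p : V} :
    p ∈ Φ.source ↔ B.proj p ∈ e.source := by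
  rw [h.source_eq]
  rfl

theorem IsBundleChart.mem_target (h : B.IsBundleChart F G H e Φ) {z : F × G} :
    z ∈ Φ.target ↔ z.1 ∈ e.target := by
  rw [h.target_eq]
  simp

theorem IsBundleChart.apply_eq (h : B.IsBundleChart F G H e Φ) {p : V}
    (hp : B.proj p ∈ e.source) : Φ p = (e (B.proj p), (Φ p).2) :=
  Prod.ext (h.fst_eq p (h.mem_source.2 hp)) rfl

theorem IsBundleChart.proj_symm (h : B.IsBundleChart F G H e Φ) {z : F × G}
    (hz : z.1 ∈ e.target) : B.proj (Φ.symm z) = e.symm z.1 := by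
  have h1 := Φ.map_target (h.mem_target.2 hz)
  have h2 := h.fst_eq _ h1
  rw [Φ.right_inv (h.mem_target.2 hz)] at h2
  rw [h2, e.left_inv (h.mem_source.1 h1)]

/-- The vector of the fibre over `x` with coordinate `g` in a bundle chart. -/
noncomputable def IsBundleChart.lift (h : B.IsBundleChart F G H e Φ) {x : M} (hx : x ∈ e.source)
    (g : G) : B.Fibre x :=
  ⟨Φ.symm (e x, g), (h.proj_symm (e.map_source hx)).trans (e.left_inv hx)⟩

theorem IsBundleChart.apply_lift (h : B.IsBundleChart F G H e Φ) {x : M} (hx : x ∈ e.source)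
    (g : G) : (Φ (h.lift hx g).1).2 = g :=
  congrArg Prod.snd (Φ.right_inv (h.mem_target.2 (e.map_source hx) : (e x, g) ∈ Φ.target))

theorem IsBundleChart.lift_apply (h : B.IsBundleChart F G H e Φ) {x : M} (hx : x ∈ e.source)
    (p : B.Fibre x) : h.lift hx (Φ p.1).2 = p := by
  obtain ⟨p, rfl⟩ := p
  apply Subtype.ext
  change Φ.symm (e (B.proj p), (Φ p).2) = p
  rw [← h.apply_eq hx, Φ.left_inv (h.mem_source.2 hx)]

theorem IsBundleChart.lift_isLinearMap (h : B.IsBundleChart F G H e Φ) {x : M}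
    (hx : x ∈ e.source) : IsLinearMap ℝ (h.lift hx) := by
  constructor
  · intro g g'
    rw [← h.lift_apply hx (h.lift hx g + h.lift hx g'), (h.linear x hx).map_add,
      h.apply_lift, h.apply_lift]
  · intro a g
    rw [← h.lift_apply hx (a • h.lift hx g), (h.linear x hx).map_smul, h.apply_lift]

theorem IsBundleChart.fibreDeriv_eq (h : B.IsBundleChart F G H e Φ) {ξ : TangentBdl H V}
    (hξ : B.proj ξ.pt ∈ e.source) : fibreDeriv F G H Φ ξ = (along Φ ξ).2 :=
  along_clm (ContinuousLinearMap.snd ℝ F G) h.smooth (h.mem_source.2 hξ)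

theorem IsBundleChart.along_fst (h : B.IsBundleChart F G H e Φ) (hB : MSmooth H F B.proj)
    {ξ : TangentBdl H V} (hξ : B.proj ξ.pt ∈ e.source) :
    (along Φ ξ).1 = along e (B.tproj F H ξ) := by
  have he := isSmoothChart_of_mem_atlas h.mem_atlas
  rw [tproj, along_tangentMap hB e.open_source he.smooth hξ]
  exact (along_clm (ContinuousLinearMap.fst ℝ F G) h.smooth (h.mem_source.2 hξ)).symm.trans
    (along_congr Φ.open_source h.fst_eq (h.mem_source.2 hξ))

theorem IsBundleChart.along_eq (h : B.IsBundleChart F G H e Φ) (hB : MSmooth H F B.proj)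
    {ξ : TangentBdl H V} (hξ : B.proj ξ.pt ∈ e.source) :
    along Φ ξ = (along e (B.tproj F H ξ), fibreDeriv F G H Φ ξ) :=
  Prod.ext (h.along_fst hB hξ) (h.fibreDeriv_eq hξ).symm

theorem along_eq_zero {x : M} (he : e ∈ atlas F M) (hx : x ∈ e.source) {ξ : TangentBdl F M}
    (h : ξ.pt = x) (hξ : ξ.vec = 0) : along e ξ = 0 := by
  rcases ξ with ⟨y, v⟩
  obtain rfl : y = x := h
  obtain rfl : v = 0 := hξ
  exact (isLinearMap_along e.open_source (isSmoothChart_of_mem_atlas he).smooth hx).map_zero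

variable (F H H') in
/-- Smooth maps over the identity of the base which are linear on the fibres. -/
structure IsBundleMap (B : VectorFibration M V) (B' : VectorFibration M V') (φ : V → V') :
    Prop where
  smooth : MSmooth H H' φ
  proj_eq : ∀ p, B'.proj (φ p) = B.proj p
  linear : ∀ x, IsLinearMap ℝ
    (fun p : B.Fibre x => (⟨φ p.1, (proj_eq p.1).trans p.2⟩ : B'.Fibre x))

theorem IsBundleMap.id (B : VectorFibration M V) : IsBundleMap H H B B (fun p => p) :=
  ⟨MSmooth.id, fun _ => rfl, fun _ => ⟨fun _ _ => rfl, fun _ _ => rfl⟩⟩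

variable {φ : V → V'}

/-- Functoriality of the tangent map applied to `Π' ∘ φ = Π`. Consequently `Tφ` preserves
verticality and the relation of lying over the same vector of `TM`. -/
theorem IsBundleMap.tproj_tangentMap (hφ : IsBundleMap H H' B B' φ) (hB' : MSmooth H' F B'.proj)
    (ξ : TangentBdl H V) : B'.tproj F H' (tangentMap H H' φ ξ) = B.tproj F H ξ := by
  have h : (fun p => B'.proj (φ p)) = B.proj := funext hφ.proj_eq
  rw [tproj, tangentMap_comp hB' hφ.smooth, h]
  rfl

theorem IsBundleMap.fibreDeriv_tangentMap (hφ : IsBundleMap H H' B B' φ)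
    (hΦ : B.IsBundleChart F G H e Φ) (hΨ : B'.IsBundleChart F G' H' e' Ψ) {ξ : TangentBdl H V}
    (hξ : B.proj ξ.pt ∈ e.source) (hξ' : B.proj ξ.pt ∈ e'.source) :
    fibreDeriv F G' H' Ψ (tangentMap H H' φ ξ) =
      dirDeriv (fun z => (Ψ (φ (Φ.symm z))).2) (Φ ξ.pt) (along Φ ξ) := by
  have hs : φ ξ.pt ∈ Ψ.source := hΨ.mem_source.2 (by rwa [hφ.proj_eq])
  have h1 : SmoothFunOn H' (fun p => (Ψ p).2) Ψ.source :=
    hΨ.isSmoothChart.smooth.comp Ψ.open_source isOpen_univ (SmoothMB.snd (E := F) (E' := G'))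
      (mapsTo_univ _ _)
  exact (along_tangentMap hφ.smooth Ψ.open_source h1 hs).trans
    (along_eq_dirDeriv (Ψ.open_source.preimage hφ.smooth.1)
      (hφ.smooth.smoothFunOn Ψ.open_source h1) hΦ.isSmoothChart hs (hΦ.mem_source.2 hξ))

/-- The tangent map of a bundle map preserves linear combinations with respect to the vector
space structures on the fibres of `TΠ`; these may be tested in one bundle chart of the source. -/
theorem IsBundleMap.isTangentComb (hφ : IsBundleMap H H' B B' φ) (hB : MSmooth H F B.proj)
    (hB' : MSmooth H' F B'.proj) (hΦ : B.IsBundleChart F G H e Φ) {a b : ℝ}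
    {ξ η ζ : TangentBdl H V} (hξζ : B.tproj F H ξ = B.tproj F H ζ)
    (hηζ : B.tproj F H η = B.tproj F H ζ) (hζ : B.proj ζ.pt ∈ e.source)
    (h₀ : (Φ ζ.pt).2 = a • (Φ ξ.pt).2 + b • (Φ η.pt).2)
    (h₁ : fibreDeriv F G H Φ ζ = a • fibreDeriv F G H Φ ξ + b • fibreDeriv F G H Φ η) :
    B'.IsTangentComb F G' H' a b (tangentMap H H' φ ξ) (tangentMap H H' φ η)
      (tangentMap H H' φ ζ) := by
  have hpξ : B.proj ξ.pt = B.proj ζ.pt := congrArg TangentBdl.pt hξζ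
  have hpη : B.proj η.pt = B.proj ζ.pt := congrArg TangentBdl.pt hηζ
  refine ⟨by simp only [hφ.tproj_tangentMap hB', hξζ], by simp only [hφ.tproj_tangentMap hB', hηζ],
    fun e' Ψ hΨ hζ' => ?_⟩
  replace hζ' : B.proj ζ.pt ∈ e'.source := by rw [← hφ.proj_eq]; exact hζ'
  set ψ : F × G → G' := fun z => (Ψ (φ (Φ.symm z))).2
  have hU : IsOpen (e.target ∩ e.symm ⁻¹' e'.source) := e.isOpen_inter_preimage_symm e'.open_source
  have hψ : SmoothMB ψ ((e.target ∩ e.symm ⁻¹' e'.source) ×ˢ univ) := by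
    refine SmoothMB.mono ?_ (((hφ.smooth.chart hΨ.isSmoothChart).comp
      (Ψ.open_source.preimage hφ.smooth.1) isOpen_univ (SmoothMB.snd (E := F) (E' := G'))
      (mapsTo_univ _ _)).smooth_symm (Ψ.open_source.preimage hφ.smooth.1) hΦ.isSmoothChart)
    rintro ⟨y, g⟩ ⟨⟨hy, hy'⟩, -⟩
    refine ⟨hΦ.mem_target.2 hy, hΨ.mem_source.2 ?_⟩
    rw [hφ.proj_eq, hΦ.proj_symm hy]
    exact hy'
  have hlin : ∀ y ∈ e.target ∩ e.symm ⁻¹' e'.source, IsLinearMap ℝ (fun g => ψ (y, g)) := by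
    rintro y ⟨hy, hy'⟩
    have hx := e.map_target hy
    have h1 := ((IsLinearMap.mk' _ (hΨ.linear _ hy')).comp
      ((IsLinearMap.mk' _ (hφ.linear _)).comp
        (IsLinearMap.mk' _ (hΦ.lift_isLinearMap hx)))).isLinear
    have h2 : (fun g => ψ (y, g)) = fun g => (Ψ (φ (hΦ.lift hx g).1)).2 := by
      funext g
      simp only [ψ, IsBundleChart.lift, e.right_inv hy]
    rw [h2]
    exact h1
  have hy : e (B.proj ζ.pt) ∈ e.target ∩ e.symm ⁻¹' e'.source :=
    ⟨e.map_source hζ, by simpa [e.left_inv hζ] using hζ'⟩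
  constructor
  · have key {η : TangentBdl H V} (h : B.proj η.pt = B.proj ζ.pt) :
        (Ψ (φ η.pt)).2 = ψ (e (B.proj ζ.pt), (Φ η.pt).2) := by
      have hη : B.proj η.pt ∈ e.source := by rwa [h]
      rw [← h, ← hΦ.apply_eq hη]
      simp only [ψ, Φ.left_inv (hΦ.mem_source.2 hη)]
    change (Ψ (φ ζ.pt)).2 = a • (Ψ (φ ξ.pt)).2 + b • (Ψ (φ η.pt)).2
    rw [key hpξ, key hpη, key rfl, h₀]
    have h3 := (hlin _ hy).map_add (a • (Φ ξ.pt).2) (b • (Φ η.pt).2)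
    simp only [(hlin _ hy).map_smul] at h3
    exact h3
  -- All three vectors have the same base coordinate and the same coordinates in `TM`, so their
  -- images differ only through the pairs formed by fibre coordinate and fibre derivative.
  · have key {η : TangentBdl H V} (h : B.tproj F H η = B.tproj F H ζ) :
        fibreDeriv F G' H' Ψ (tangentMap H H' φ η) =
          dirDeriv ψ (e (B.proj ζ.pt), (Φ η.pt).2)
            (along e (B.tproj F H ζ), fibreDeriv F G H Φ η) := by
      have hp : B.proj η.pt = B.proj ζ.pt := congrArg TangentBdl.pt h
      have hη : B.proj η.pt ∈ e.source := by rwa [hp]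
      rw [hφ.fibreDeriv_tangentMap hΦ hΨ hη (by rwa [hp]), hΦ.along_eq hB hη, h, ← hp,
        ← hΦ.apply_eq hη]
    rw [key hξζ, key hηζ, key rfl, h₀, h₁]
    exact dirDeriv_comb_of_linear hU hψ hlin hy a b _ _ _ _ _

theorem IsBundleMap.isTangentComb_tangentMap (hφ : IsBundleMap H H' B B' φ)
    (hB : B.IsVectorBundle F G H) (hB' : MSmooth H' F B'.proj) {a b : ℝ} {ξ η ζ : TangentBdl H V}
    (h : B.IsTangentComb F G H a b ξ η ζ) :
    B'.IsTangentComb F G' H' a b (tangentMap H H' φ ξ) (tangentMap H H' φ η)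
      (tangentMap H H' φ ζ) := by
  obtain ⟨e, Φ, hx, hΦ⟩ := hB.2 (B.proj ζ.pt)
  obtain ⟨h₀, h₁⟩ := h.2.2 e Φ hΦ hx
  exact hφ.isTangentComb hB.1 hB' hΦ h.1 h.2.1 hx h₀ h₁

/-- The case of the identity bundle map: the changes of bundle chart are fibrewise linear, so
checking one bundle chart settles all of them. -/
theorem IsBundleChart.isTangentComb (hΦ : B.IsBundleChart F G H e Φ) (hB : MSmooth H F B.proj)
    {a b : ℝ} {ξ η ζ : TangentBdl H V} (hξζ : B.tproj F H ξ = B.tproj F H ζ)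
    (hηζ : B.tproj F H η = B.tproj F H ζ) (hζ : B.proj ζ.pt ∈ e.source)
    (h₀ : (Φ ζ.pt).2 = a • (Φ ξ.pt).2 + b • (Φ η.pt).2)
    (h₁ : fibreDeriv F G H Φ ζ = a • fibreDeriv F G H Φ ξ + b • fibreDeriv F G H Φ η) :
    B.IsTangentComb F G H a b ξ η ζ := by
  have h := (IsBundleMap.id B).isTangentComb (G' := G) hB hB hΦ hξζ hηζ hζ h₀ h₁
  simpa only [tangentMap_id] using h

/-! ### Vertical lifts -/

theorem IsBundleChart.line_eq (hΦ : B.IsBundleChart F G H e Φ) {x : M} (hx : x ∈ e.source)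
    (p q : B.Fibre x) (t : ℝ) :
    (p + t • q : B.Fibre x).1 = Φ.symm (e x, (Φ p.1).2 + t • (Φ q.1).2) := by
  conv_lhs => rw [← hΦ.lift_apply hx (p + t • q), (hΦ.linear x hx).map_add,
    (hΦ.linear x hx).map_smul]
  rfl

/-- The chart is linear on fibres, so it turns `t ↦ p + t q` into an affine line with constant base
coordinate. The work lies in passing from the preferred chart of `V`, in which the lift is defined,
to `Φ`. -/
theorem IsBundleChart.along_verticalLift (hΦ : B.IsBundleChart F G H e Φ) {x : M}
    (hx : x ∈ e.source) (p q : B.Fibre x) :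
    along Φ (B.verticalLift H p q) = (0, (Φ q.1).2) := by
  obtain ⟨p, rfl⟩ := p
  set c := chartAt H p
  have hp : p ∈ Φ.source := hΦ.mem_source.2 hx
  have hpc : p ∈ c.source := mem_chart_source H p
  set ℓ : ℝ → F × G := fun t => (e (B.proj p), (Φ p).2 + t • (Φ q.1).2) with hℓ
  have hℓ0 : ℓ 0 = Φ p := by
    simp only [hℓ, zero_smul, add_zero]
    exact (hΦ.apply_eq hx).symm
  have hℓd : HasDirDeriv ℓ 0 1 (0, (Φ q.1).2) := hasDirDeriv_affine _ _ _
  have hℓc : Continuous ℓ := by fun_prop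
  have hvec : (B.verticalLift H ⟨p, rfl⟩ q).vec =
      dirDeriv (fun t : ℝ => c (Φ.symm (ℓ t))) 0 1 := by
    have h (t : ℝ) := congrArg c (hΦ.line_eq hx ⟨p, rfl⟩ q t)
    exact congrArg (fun f : ℝ → H => dirDeriv f 0 1) (funext h)
  have h1 : HasDirDeriv (fun t : ℝ => c (Φ.symm (ℓ t))) 0 1 _ :=
    hℓd.comp (Φ.symm.trans c).open_source (hΦ.smooth_symm c (chart_mem_atlas H p) 1)
      (by rw [hℓ0]; exact ⟨Φ.map_source hp, by simpa [Φ.left_inv hp] using hpc⟩)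
  rw [← h1.eq, ← hvec] at h1
  have h2 := h1.comp (isOpen_chart_preimage c Φ.open_source)
    (hΦ.isSmoothChart.smooth c (chart_mem_atlas H p) 1)
    (by rw [hℓ0, Φ.left_inv hp]; exact mem_chartAt_preimage hp)
  have ho : IsOpen (ℓ ⁻¹' (Φ.target ∩ Φ.symm ⁻¹' c.source)) :=
    (Φ.isOpen_inter_preimage_symm c.open_source).preimage hℓc
  -- Going to the chart `c` and back is the identity only while the curve stays in its domain; this
  -- holds for `t` near `0`.
  have h3 := h2.congr (g := ℓ) ho (fun t ht => by
    have h4 : c.symm (c (Φ.symm (ℓ t))) = Φ.symm (ℓ t) := c.left_inv ht.2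
    simp only [h4, Φ.right_inv ht.1])
    (by
      rw [mem_preimage, hℓ0]
      exact ⟨Φ.map_source hp, by simpa [Φ.left_inv hp] using hpc⟩)
  have h5 := h3.eq.symm.trans hℓd.eq
  rw [hℓ0, Φ.left_inv hp] at h5
  exact h5

/-- Fibrewise linearity sends the line `p + t q` to the line `φ p + t φ q`; the velocities at `t =
0` are then compared in a bundle chart of the target. -/
theorem IsBundleMap.tangentMap_verticalLift (hφ : IsBundleMap H H' B B' φ)
    (hB : B.IsVectorBundle F G H) (hB' : B'.IsVectorBundle F G' H') {x : M} (p q : B.Fibre x) :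
    tangentMap H H' φ (B.verticalLift H p q) =
      B'.verticalLift H' (⟨φ p.1, (hφ.proj_eq p.1).trans p.2⟩ : B'.Fibre x)
        ⟨φ q.1, (hφ.proj_eq q.1).trans q.2⟩ := by
  obtain ⟨e, Φ, hx, hΦ⟩ := hB.2 x
  obtain ⟨e', Ψ, hx', hΨ⟩ := hB'.2 x
  have hp : p.1 ∈ Φ.source := hΦ.mem_source.2 (by rwa [p.2])
  have hp' : φ p.1 ∈ Ψ.source := hΨ.mem_source.2 (by rwa [hφ.proj_eq, p.2])
  refine TangentBdl.ext_along hΨ.isSmoothChart rfl hp' ?_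
  rw [hΨ.along_verticalLift hx', along_tangentMap hφ.smooth Ψ.open_source hΨ.isSmoothChart.smooth
    hp']
  have hW := Ψ.open_source.preimage hφ.smooth.1
  have hf := hφ.smooth.chart hΨ.isSmoothChart
  rw [along_eq_dirDeriv hW hf hΦ.isSmoothChart (ξ := B.verticalLift H p q) hp' hp,
    hΦ.along_verticalLift hx]
  set ℓ : ℝ → F × G := fun t => (e x, (Φ p.1).2 + t • (Φ q.1).2) with hℓ
  have hℓ0 : ℓ 0 = Φ p.1 := by
    simp only [hℓ, zero_smul, add_zero]
    rw [hΦ.apply_eq (p := p.1) (by rwa [p.2]), p.2]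
  have hℓd : HasDirDeriv ℓ 0 1 (0, (Φ q.1).2) := hasDirDeriv_affine _ _ _
  have h1 := hℓd.comp (Φ.isOpen_inter_preimage_symm hW) (hf.smooth_symm hW hΦ.isSmoothChart 1)
    (by rw [hℓ0]; exact ⟨Φ.map_source hp, by simpa [Φ.left_inv hp] using hp'⟩)
  have h2 : (fun t => Ψ (φ (Φ.symm (ℓ t)))) =
      fun t : ℝ => (e' x, (Ψ (φ p.1)).2 + t • (Ψ (φ q.1)).2) := by
    funext t
    have h3 := (hφ.linear x).map_add p (t • q)
    rw [(hφ.linear x).map_smul] at h3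
    have h4 := congrArg (fun r : B'.Fibre x => (Ψ r.1).2) h3
    simp only [(hΨ.linear x hx').map_add, (hΨ.linear x hx').map_smul] at h4
    have hr : B'.proj (φ (p + t • q : B.Fibre x).1) = x := by
      rw [hφ.proj_eq, (p + t • q : B.Fibre x).2]
    rw [← hΦ.line_eq hx, hΨ.apply_eq (by rwa [hr]), hr, h4]
  rw [h2, hℓ0] at h1
  exact h1.eq.symm.trans (hasDirDeriv_affine _ _ _).eq

theorem IsBundleMap.sameVerticalPart (hφ : IsBundleMap H H' B B' φ)
    (hB : B.IsVectorBundle F G H) (hB' : B'.IsVectorBundle F G' H') {ξ η : TangentBdl H V}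
    (h : B.SameVerticalPart H ξ η) :
    B'.SameVerticalPart H' (tangentMap H H' φ ξ) (tangentMap H H' φ η) := by
  obtain ⟨x, p, p', q, rfl, rfl⟩ := h
  exact ⟨x, _, _, _, hφ.tangentMap_verticalLift hB hB' p q, hφ.tangentMap_verticalLift hB hB' p' q⟩

/-- A linear connection induces linear connections on direct summands. -/
theorem IsLinearConnection.summand {ι : V → V'} {π : V' → V} (hι : IsBundleMap H H' B B' ι)
    (hπ : IsBundleMap H' H B' B π) (hπι : ∀ p, π (ι p) = p) (hB : B.IsVectorBundle F G H)
    (hB' : B'.IsVectorBundle F G' H') {D : TangentBdl H' V' → TangentBdl H' V'}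
    (hD : B'.IsLinearConnection F G' H' D) :
    B.IsLinearConnection F G H
      (fun ξ => tangentMap H' H π (D (tangentMap H H' ι ξ))) where
  smooth := hπ.smooth.tangentMap.comp (hD.smooth.comp hι.smooth.tangentMap)
  pt_eq ξ := (congrArg π (hD.pt_eq _)).trans (hπι _)
  linear p := by
    have h1 := ((IsLinearMap.mk' _ (isLinearMap_tangentMap hπ.smooth (ι p))).comp
      ((IsLinearMap.mk' _ (hD.linear (ι p))).comp
        (IsLinearMap.mk' _ (isLinearMap_tangentMap hι.smooth p)))).isLinear
    -- The composite of linear maps has the base point `ι p` written out, whereas the value of `D`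
    -- carries its own; they agree because `D` preserves base points.
    refine cast (congrArg (IsLinearMap ℝ) (funext fun z => ?_)) h1
    refine congrArg (fun η => (tangentMap H' H π η).vec) ?_
    exact TangentBdl.ext (hD.pt_eq (tangentMap H H' ι ⟨p, z⟩)).symm rfl
  vertical ξ := by
    rw [hπ.tproj_tangentMap hB.1]
    exact hD.vertical _
  of_vertical ξ hξ := by
    rw [hD.of_vertical _ (by rwa [hι.tproj_tangentMap hB'.1]), tangentMap_comp hπ.smooth hι.smooth]
    have h : (fun p => π (ι p)) = fun p => p := funext hπι
    rw [h, tangentMap_id]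
  linear_tproj a b ξ η ζ h :=
    hπ.isTangentComb_tangentMap hB' hB.1
      (hD.linear_tproj a b _ _ _ (hι.isTangentComb_tangentMap hB hB'.1 h))

end VectorFibration

end Bundle

/-! ### Connections on direct sums -/

namespace VectorFibration

section Sum

variable {F : Type u} [AddCommGroup F] [Module ℝ F] [TopologicalSpace F]
  [IsTopologicalAddGroup F] [ContinuousSMul ℝ F] [LocallyConvexSpace ℝ F] [T2Space F]
  {G : Type u} [AddCommGroup G] [Module ℝ G] [TopologicalSpace G]
  [IsTopologicalAddGroup G] [ContinuousSMul ℝ G] [LocallyConvexSpace ℝ G] [T2Space G]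
  {H : Type u} [AddCommGroup H] [Module ℝ H] [TopologicalSpace H]
  [IsTopologicalAddGroup H] [ContinuousSMul ℝ H] [LocallyConvexSpace ℝ H] [T2Space H]
  {H' : Type u} [AddCommGroup H'] [Module ℝ H'] [TopologicalSpace H']
  [IsTopologicalAddGroup H'] [ContinuousSMul ℝ H'] [LocallyConvexSpace ℝ H'] [T2Space H']
  {M : Type v} [TopologicalSpace M] [ChartedSpace F M] [SmoothManifold F M]
  {V : Type w} [TopologicalSpace V] [ChartedSpace H V] [SmoothManifold H V]
  {V' : Type w} [TopologicalSpace V'] [ChartedSpace H' V'] [SmoothManifold H' V']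
  {B : VectorFibration M V} {B' : VectorFibration M V'}

theorem IsBundleChart.fibreDeriv_tangentMap {e : OpenPartialHomeomorph M F}
    {Ψ : OpenPartialHomeomorph V (F × G)} (hΨ : B.IsBundleChart F G H e Ψ) {φ : V' → V}
    (hφ : IsBundleMap H' H B' B φ) {ξ : TangentBdl H' V'} (hξ : B'.proj ξ.pt ∈ e.source) :
    fibreDeriv F G H Ψ (tangentMap H' H φ ξ) = along (fun p => (Ψ (φ p)).2) ξ :=
  along_tangentMap hφ.smooth Ψ.open_source (hΨ.isSmoothChart.smooth.comp Ψ.open_source isOpen_univ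
    (SmoothMB.snd (E := F) (E' := G)) (mapsTo_univ _ _))
    (hΨ.mem_source.2 (by rwa [hφ.proj_eq]))

/-- The values of a connection are vertical, so their base coordinates vanish and only the fibre
derivative carries information. -/
theorem IsConnection.along_fst {C : TangentBdl H V → TangentBdl H V}
    (hC : B.IsConnection F H C) {e : OpenPartialHomeomorph M F} (he : e ∈ atlas F M)
    {ξ : TangentBdl H V} (hξ : B.proj ξ.pt ∈ e.source) : along e (B.tproj F H (C ξ)) = 0 :=
  along_eq_zero he hξ (congrArg B.proj (hC.pt_eq ξ)) (hC.vertical ξ)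

/-- A linear connection maps tangent vectors of the zero section to zero vertical vectors. -/
theorem IsLinearConnection.tangentMap_zero {C : TangentBdl H V → TangentBdl H V}
    (hC : B.IsLinearConnection F G H C) (hB : B.IsVectorBundle F G H) {z : V → V}
    (hz : IsBundleMap H H B B z) (hz0 : ∀ p, z p = (0 : B.Fibre (B.proj p)).1)
    (ξ : TangentBdl H V) : C (tangentMap H H z ξ) = tangentMap H H z (C ξ) := by
  obtain ⟨e, Ψ, hx, hΨ⟩ := hB.2 (B.proj ξ.pt)
  have hx' : B.proj (C ξ).pt ∈ e.source := by rwa [hC.pt_eq]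
  have hzΨ (p : V) (hp : B.proj p ∈ e.source) : (Ψ (z p)).2 = 0 := by
    rw [hz0]
    exact (hΨ.linear _ hp).map_zero
  have hzd (η : TangentBdl H V) (hη : B.proj η.pt ∈ e.source) :
      fibreDeriv F G H Ψ (tangentMap H H z η) = 0 := by
    rw [hΨ.fibreDeriv_tangentMap hz hη]
    exact (along_congr (g := fun _ => 0) (e.open_source.preimage hB.1.1)
      (fun p hp => hzΨ p hp) hη).trans (along_const _ _)
  have hzx : B.proj (tangentMap H H z ξ).pt ∈ e.source := by
    change B.proj (z ξ.pt) ∈ e.source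
    rwa [hz.proj_eq]
  -- A tangent vector of the zero section is the zero of its fibre of `TΠ`, here expressed as `0 ξ +
  -- 0 ξ`; the connection therefore maps it to a vertical vector with zero fibre derivative.
  have h1 : B.IsTangentComb F G H 0 0 ξ ξ (tangentMap H H z ξ) := by
    refine hΨ.isTangentComb hB.1 (hz.tproj_tangentMap hB.1 ξ).symm
      (hz.tproj_tangentMap hB.1 ξ).symm hzx ?_ ?_
    · rw [zero_smul, add_zero]
      exact hzΨ ξ.pt hx
    · rw [zero_smul, add_zero]
      exact hzd ξ hx
  have h2 := ((hC.linear_tproj 0 0 _ _ _ h1).2.2 e Ψ hΨ (by rwa [hC.pt_eq])).2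
  simp only [zero_smul, add_zero] at h2
  have hp : (C (tangentMap H H z ξ)).pt = (tangentMap H H z (C ξ)).pt := by
    rw [hC.pt_eq]
    exact congrArg z (hC.pt_eq ξ).symm
  refine TangentBdl.ext_along hΨ.isSmoothChart hp
    (hΨ.mem_source.2 (by rwa [hC.pt_eq])) ?_
  rw [hΨ.along_eq hB.1 (by rwa [hC.pt_eq]), hΨ.along_eq hB.1 (by rwa [← hp, hC.pt_eq]), h2,
    hzd _ hx', hz.tproj_tangentMap hB.1, hC.along_fst hΨ.mem_atlas hx,
    hC.along_fst hΨ.mem_atlas hzx]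

variable (F G H H') in
/-- `B'` is the direct sum `B ⊕ B`, with projections `pr` and inclusions `ι`. -/
structure IsBundleSum (B : VectorFibration M V) (B' : VectorFibration M V')
    (pr : Fin 2 → V' → V) (ι : Fin 2 → V → V') : Prop where
  pr_map : ∀ i, IsBundleMap H' H B' B (pr i)
  ι_map : ∀ i, IsBundleMap H H' B B' (ι i)
  pr_ι : ∀ i p, pr i (ι i p) = p
  pr_ι_ne : ∀ i j, i ≠ j → ∀ p, pr j (ι i p) = (0 : B.Fibre (B.proj p)).1
  charts : ∀ x : M, ∃ (e : OpenPartialHomeomorph M F) (Ψ : OpenPartialHomeomorph V (F × G))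
    (Φ : OpenPartialHomeomorph V' (F × (G × G))), x ∈ e.source ∧ B.IsBundleChart F G H e Ψ ∧
      B'.IsBundleChart F (G × G) H' e Φ ∧
      ∀ p, B'.proj p ∈ e.source → (Φ p).2 = ((Ψ (pr 0 p)).2, (Ψ (pr 1 p)).2)

variable {pr : Fin 2 → V' → V} {ι : Fin 2 → V → V'}

theorem IsBundleSum.fibreDeriv_eq (h : IsBundleSum F G H H' B B' pr ι)
    (hB' : MSmooth H' F B'.proj) {e : OpenPartialHomeomorph M F}
    {Ψ : OpenPartialHomeomorph V (F × G)} {Φ : OpenPartialHomeomorph V' (F × (G × G))}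
    (hΨ : B.IsBundleChart F G H e Ψ)
    (hΦΨ : ∀ p, B'.proj p ∈ e.source → (Φ p).2 = ((Ψ (pr 0 p)).2, (Ψ (pr 1 p)).2))
    {ξ : TangentBdl H' V'} (hξ : B'.proj ξ.pt ∈ e.source) :
    fibreDeriv F (G × G) H' Φ ξ = (fibreDeriv F G H Ψ (tangentMap H' H (pr 0) ξ),
      fibreDeriv F G H Ψ (tangentMap H' H (pr 1) ξ)) := by
  have hs (i : Fin 2) : SmoothFunOn H' (fun p => (Ψ (pr i p)).2) (B'.proj ⁻¹' e.source) :=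
    (((h.pr_map i).smooth.chart hΨ.isSmoothChart).comp
      (Ψ.open_source.preimage (h.pr_map i).smooth.1) isOpen_univ (SmoothMB.snd (E := F) (E' := G))
      (mapsTo_univ _ _)).mono fun p hp => hΨ.mem_source.2 (by rwa [(h.pr_map i).proj_eq])
  rw [hΨ.fibreDeriv_tangentMap (h.pr_map 0) hξ, hΨ.fibreDeriv_tangentMap (h.pr_map 1) hξ,
    ← along_prodMk (hs 0) (hs 1) hξ]
  exact along_congr (e.open_source.preimage hB'.1) (fun p hp => hΦΨ p hp) hξ

/-- In an adapted chart the fibre derivative is the pair of the fibre derivatives of the two images,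
and the base coordinates are already seen by either image. This is the source of uniqueness in (1).
-/
theorem IsBundleSum.ext_tangent (h : IsBundleSum F G H H' B B' pr ι) (hB : MSmooth H F B.proj)
    (hB' : MSmooth H' F B'.proj) {ξ η : TangentBdl H' V'} (hp : ξ.pt = η.pt)
    (hpr : ∀ i, tangentMap H' H (pr i) ξ = tangentMap H' H (pr i) η) : ξ = η := by
  obtain ⟨e, Ψ, Φ, hx, hΨ, hΦ, hΦΨ⟩ := h.charts (B'.proj ξ.pt)
  have hx' : B'.proj η.pt ∈ e.source := by rwa [← hp]
  refine TangentBdl.ext_along hΦ.isSmoothChart hp (hΦ.mem_source.2 hx) ?_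
  rw [hΦ.along_eq hB' hx, hΦ.along_eq hB' hx', h.fibreDeriv_eq hB' hΨ hΦΨ hx,
    h.fibreDeriv_eq hB' hΨ hΦΨ hx', hpr, hpr, ← (h.pr_map 0).tproj_tangentMap hB, hpr,
    (h.pr_map 0).tproj_tangentMap hB]

theorem IsBundleSum.proj_smooth (h : IsBundleSum F G H H' B B' pr ι) (hB : MSmooth H F B.proj) :
    MSmooth H' F B'.proj := by
  have h1 : (fun p => B.proj (pr 0 p)) = B'.proj := funext (h.pr_map 0).proj_eq
  rw [← h1]
  exact hB.comp (h.pr_map 0).smooth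

theorem IsBundleSum.isVectorBundle (h : IsBundleSum F G H H' B B' pr ι)
    (hB : MSmooth H F B.proj) : B'.IsVectorBundle F (G × G) H' :=
  ⟨h.proj_smooth hB, fun x => by
    obtain ⟨e, Ψ, Φ, hx, -, hΦ, -⟩ := h.charts x
    exact ⟨e, Φ, hx, hΦ⟩⟩

variable {C : TangentBdl H V → TangentBdl H V}

/-- The two prescribed images are vertical, hence compatible over `TM`: the vector with base
coordinates `0` and the two prescribed fibre derivatives has them as its projections. -/
theorem IsBundleSum.exists_tangent (h : IsBundleSum F G H H' B B' pr ι) (hB : MSmooth H F B.proj)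
    (hC : B.IsConnection F H C) (ξ : TangentBdl H' V') :
    ∃ η : TangentBdl H' V', η.pt = ξ.pt ∧
      ∀ i, tangentMap H' H (pr i) η = C (tangentMap H' H (pr i) ξ) := by
  have hB' := h.proj_smooth hB
  obtain ⟨e, Ψ, Φ, hx, hΨ, hΦ, hΦΨ⟩ := h.charts (B'.proj ξ.pt)
  obtain ⟨v, hv⟩ := exists_along_eq hΦ.isSmoothChart (hΦ.mem_source.2 hx)
    (0, (fibreDeriv F G H Ψ (C (tangentMap H' H (pr 0) ξ)),
      fibreDeriv F G H Ψ (C (tangentMap H' H (pr 1) ξ))))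
  set η : TangentBdl H' V' := ⟨ξ.pt, v⟩
  have hη : B'.proj η.pt ∈ e.source := hx
  refine ⟨η, rfl, ?_⟩
  rw [hΦ.along_eq hB' hη, h.fibreDeriv_eq hB' hΨ hΦΨ hη, Prod.mk.injEq, Prod.mk.injEq] at hv
  have hξi (i : Fin 2) : B.proj (tangentMap H' H (pr i) ξ).pt ∈ e.source := by
    change B.proj (pr i ξ.pt) ∈ e.source
    rwa [(h.pr_map i).proj_eq]
  have key (i : Fin 2) (hi : fibreDeriv F G H Ψ (tangentMap H' H (pr i) η) =
      fibreDeriv F G H Ψ (C (tangentMap H' H (pr i) ξ))) :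
      tangentMap H' H (pr i) η = C (tangentMap H' H (pr i) ξ) := by
    refine TangentBdl.ext_along hΨ.isSmoothChart
      (hC.pt_eq (tangentMap H' H (pr i) ξ)).symm (hΨ.mem_source.2 (hξi i)) ?_
    rw [hΨ.along_eq hB (ξ := tangentMap H' H (pr i) η) (hξi i), hΨ.along_eq hB (by rw [hC.pt_eq]; exact hξi i),
      hi,
      (h.pr_map i).tproj_tangentMap hB, hv.1, hC.along_fst hΨ.mem_atlas (hξi i)]
  exact Fin.forall_fin_two.2 ⟨key 0 hv.2.1, key 1 hv.2.2⟩

variable {D : TangentBdl H' V' → TangentBdl H' V'}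

/-- A map `D` with these projections has coordinates `(0, (f₀, f₁))` in an adapted bundle chart,
where `fᵢ` is the fibre derivative of `C (T pr_i ξ)`. These depend smoothly on `ξ`, even if `D` was
obtained pointwise by choice. -/
theorem IsBundleSum.smooth_of_tangentMap_pr (h : IsBundleSum F G H H' B B' pr ι)
    (hB : MSmooth H F B.proj) (hC : B.IsConnection F H C) (hpt : ∀ ξ, (D ξ).pt = ξ.pt)
    (hD : ∀ i ξ, tangentMap H' H (pr i) (D ξ) = C (tangentMap H' H (pr i) ξ)) :
    MSmooth (H' × H') (H' × H') D := by
  have hB' := h.proj_smooth hB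
  refine MSmooth.of_charts fun ξ₀ => ?_
  obtain ⟨e, Ψ, Φ, hx, hΨ, hΦ, hΦΨ⟩ := h.charts (B'.proj ξ₀.pt)
  set c : atlas H' V' := ⟨chartAt H' ξ₀.pt, chart_mem_atlas H' _⟩
  have hc := isSmoothChart_of_mem_atlas c.2
  set W₀ : Set V' := c.1.source ∩ Φ.source
  have hW₀ : IsOpen W₀ := c.1.open_source.inter Φ.open_source
  set W : Set (TangentBdl H' V') := {ξ | ξ.pt ∈ W₀}
  have hW : IsOpen W := hW₀.preimage MSmooth.pt.1
  refine ⟨tangentHomeo c, mem_atlas_tangent.2 ⟨c, rfl⟩, W, hW,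
    ⟨mem_chart_source H' _, hΦ.mem_source.2 hx⟩, fun ξ hξ => ?_, ?_⟩
  · change (D ξ).pt ∈ c.1.source
    rw [hpt]
    exact hξ.1
  have hU : IsOpen (Φ.target ∩ Φ.symm ⁻¹' c.1.source) :=
    Φ.isOpen_inter_preimage_symm c.1.open_source
  -- Smoothness of `D` is tested in an atlas chart `c`, so the coordinates found in `Φ` are
  -- transported by the derivative of the change `c ∘ Φ⁻¹`.
  have hg := (hc.smooth.smooth_symm c.1.open_source hΦ.isSmoothChart).dirDeriv
  have hf (i : Fin 2) : SmoothFunOn (H' × H')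
      (fun ξ => fibreDeriv F G H Ψ (C (tangentMap H' H (pr i) ξ))) W := by
    have h1 := (hC.smooth.comp (h.pr_map i).smooth.tangentMap).smoothFunOn
      (Ψ.open_source.preimage MSmooth.pt.1) (hΨ.isSmoothChart.smooth.along Ψ.open_source)
    have hm (ξ) (hξ : ξ ∈ W) : (C (tangentMap H' H (pr i) ξ)).pt ∈ Ψ.source := by
      rw [hC.pt_eq]
      change pr i ξ.pt ∈ Ψ.source
      rw [hΨ.mem_source, (h.pr_map i).proj_eq]
      exact hΦ.mem_source.1 hξ.2
    refine ((h1.mono hm).comp hW isOpen_univ (SmoothMB.snd (E := F) (E' := G))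
      (mapsTo_univ _ _)).congr hW fun ξ hξ => ?_
    exact (hΨ.fibreDeriv_eq (hΨ.mem_source.1 (hm ξ hξ))).symm
  have hb : SmoothFunOn (H' × H') (fun ξ : TangentBdl H' V' => Φ ξ.pt) W :=
    (MSmooth.pt.smoothFunOn Φ.open_source hΦ.isSmoothChart.smooth).mono fun _ hξ => hξ.2
  have h0 : SmoothFunOn (H' × H') (fun _ : TangentBdl H' V' => (0 : F)) W :=
    fun _ _ => SmoothMB.zero
  have hbf := (hb.prodMk hW (h0.prodMk hW ((hf 0).prodMk hW (hf 1)))).comp hW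
    (hU.prod isOpen_univ) hg fun ξ hξ => ⟨⟨Φ.map_source hξ.2, by
      simpa [Φ.left_inv hξ.2] using hξ.1⟩, mem_univ _⟩
  have hb' : SmoothFunOn (H' × H') (fun ξ : TangentBdl H' V' => c.1 ξ.pt) W :=
    (MSmooth.pt.smoothFunOn c.1.open_source hc.smooth).mono fun _ hξ => hξ.1
  refine (hb'.prodMk hW hbf).congr hW fun ξ hξ => ?_
  have hx' : B'.proj (D ξ).pt ∈ e.source := by
    rw [hpt]
    exact hΦ.mem_source.1 hξ.2
  have hv : along e (B'.tproj F H' (D ξ)) = 0 := by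
    rw [← (h.pr_map 0).tproj_tangentMap hB, hD]
    refine hC.along_fst hΨ.mem_atlas ?_
    change B.proj (pr 0 ξ.pt) ∈ e.source
    rw [(h.pr_map 0).proj_eq]
    exact hΦ.mem_source.1 hξ.2
  have h2 := along_eq_dirDeriv c.1.open_source hc.smooth hΦ.isSmoothChart (ξ := D ξ)
    (by rw [hpt]; exact hξ.1) (by rw [hpt]; exact hξ.2)
  rw [hΦ.along_eq hB' hx', h.fibreDeriv_eq hB' hΨ hΦΨ hx', hv, hD, hD, hpt] at h2
  rw [tangentHomeo_apply, h2, hpt]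

/-- Every clause holds after applying `T pr_0` and `T pr_1`, where it is a property of `C`. These
maps are linear on tangent spaces and on the fibres of `TΠ`, and jointly injective at a given base
point. -/
theorem IsBundleSum.isLinearConnection (h : IsBundleSum F G H H' B B' pr ι)
    (hB : B.IsVectorBundle F G H) (hC : B.IsLinearConnection F G H C)
    (hpt : ∀ ξ, (D ξ).pt = ξ.pt)
    (hD : ∀ i ξ, tangentMap H' H (pr i) (D ξ) = C (tangentMap H' H (pr i) ξ)) :
    B'.IsLinearConnection F (G × G) H' D := by
  have hB' := h.proj_smooth hB.1
  have htp (ξ) : B'.tproj F H' ξ = B.tproj F H (tangentMap H' H (pr 0) ξ) :=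
    ((h.pr_map 0).tproj_tangentMap hB.1 ξ).symm
  refine ⟨⟨h.smooth_of_tangentMap_pr hB.1 hC.toIsConnection hpt hD, hpt, fun p => ?_, fun ξ => ?_,
    fun ξ hξ => ?_⟩, fun a b ξ η ζ hζ => ?_⟩
  · have hinj {a b : H'} (hab : ∀ i, (tangentMap H' H (pr i) ⟨p, a⟩).vec =
        (tangentMap H' H (pr i) ⟨p, b⟩).vec) : a = b :=
      congrArg TangentBdl.vec (h.ext_tangent hB.1 hB' (ξ := ⟨p, a⟩) (η := ⟨p, b⟩) rfl
        fun i => TangentBdl.ext rfl (hab i))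
    have hT (i : Fin 2) := isLinearMap_tangentMap (h.pr_map i).smooth p
    have hd (i : Fin 2) (z : H') : (tangentMap H' H (pr i) ⟨p, (D ⟨p, z⟩).vec⟩).vec =
        (C ⟨pr i p, (tangentMap H' H (pr i) ⟨p, z⟩).vec⟩).vec := by
      have h1 : (⟨p, (D ⟨p, z⟩).vec⟩ : TangentBdl H' V') = D ⟨p, z⟩ :=
        TangentBdl.ext (hpt ⟨p, z⟩).symm rfl
      rw [h1, hD]
      rfl
    constructor
    · intro z z'
      refine hinj fun i => ?_
      rw [hd, (hT i).map_add, (hT i).map_add, hd, hd, (hC.linear (pr i p)).map_add]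
    · intro a z
      refine hinj fun i => ?_
      rw [hd, (hT i).map_smul, (hT i).map_smul, hd, (hC.linear (pr i p)).map_smul]
  · rw [htp, hD]
    exact hC.vertical _
  · refine h.ext_tangent hB.1 hB' (hpt ξ) fun i => ?_
    rw [hD]
    refine hC.of_vertical _ ?_
    rwa [(h.pr_map i).tproj_tangentMap hB.1]
  · have hi (i : Fin 2) := hC.linear_tproj a b _ _ _
      ((h.pr_map i).isTangentComb_tangentMap (G := G × G) (h.isVectorBundle hB.1) hB.1 hζ)
    simp only [← hD] at hi
    obtain ⟨e, Ψ, Φ, hx, hΨ, hΦ, hΦΨ⟩ := h.charts (B'.proj (D ζ).pt)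
    have h0 := hi 0
    have h1 : B'.tproj F H' (D ξ) = B'.tproj F H' (D ζ) := by
      rw [htp, htp]; exact h0.1
    have h2 : B'.tproj F H' (D η) = B'.tproj F H' (D ζ) := by
      rw [htp, htp]; exact h0.2.1
    have hpξ : B'.proj (D ξ).pt ∈ e.source := by
      rwa [show B'.proj (D ξ).pt = B'.proj (D ζ).pt from congrArg TangentBdl.pt h1]
    have hpη : B'.proj (D η).pt ∈ e.source := by
      rwa [show B'.proj (D η).pt = B'.proj (D ζ).pt from congrArg TangentBdl.pt h2]
    have hx' (i : Fin 2) : B.proj (tangentMap H' H (pr i) (D ζ)).pt ∈ e.source := by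
      change B.proj (pr i (D ζ).pt) ∈ e.source
      rwa [(h.pr_map i).proj_eq]
    obtain ⟨ha, hb⟩ := h0.2.2 e Ψ hΨ (hx' 0)
    obtain ⟨ha', hb'⟩ := (hi 1).2.2 e Ψ hΨ (hx' 1)
    refine hΦ.isTangentComb hB' h1 h2 hx ?_ ?_
    · rw [hΦΨ _ hx, hΦΨ _ hpξ, hΦΨ _ hpη]
      exact Prod.ext ha ha'
    · rw [h.fibreDeriv_eq hB' hΨ hΦΨ hx, h.fibreDeriv_eq hB' hΨ hΦΨ hpξ,
        h.fibreDeriv_eq hB' hΨ hΦΨ hpη]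
      exact Prod.ext hb hb'

/-- Compared after `T pr_j`: for `j = i` the composite `pr_j ∘ ι_i` is the identity, and for `j ≠ i`
it is the zero map, handled by `IsLinearConnection.tangentMap_zero`. This is what transfers
symmetry. -/
theorem IsBundleSum.apply_tangentMap_ι (h : IsBundleSum F G H H' B B' pr ι)
    (hB : B.IsVectorBundle F G H) (hC : B.IsLinearConnection F G H C)
    (hpt : ∀ ξ, (D ξ).pt = ξ.pt)
    (hD : ∀ i ξ, tangentMap H' H (pr i) (D ξ) = C (tangentMap H' H (pr i) ξ))
    (i : Fin 2) (ξ : TangentBdl H V) :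
    D (tangentMap H H' (ι i) ξ) = tangentMap H H' (ι i) (C ξ) := by
  refine h.ext_tangent hB.1 (h.proj_smooth hB.1) ?_ fun j => ?_
  · rw [hpt]
    exact congrArg (ι i) (hC.pt_eq ξ).symm
  · rw [hD, tangentMap_comp (h.pr_map j).smooth (h.ι_map i).smooth,
      tangentMap_comp (h.pr_map j).smooth (h.ι_map i).smooth]
    rcases eq_or_ne i j with rfl | hij
    · have h1 : (fun p => pr i (ι i p)) = fun p => p := funext (h.pr_ι i)
      rw [h1, tangentMap_id, tangentMap_id]
    · refine hC.tangentMap_zero hB ?_ (h.pr_ι_ne i j hij) ξ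
      refine ⟨(h.pr_map j).smooth.comp (h.ι_map i).smooth, fun p => ?_, fun x => ?_⟩
      · rw [(h.pr_map j).proj_eq, (h.ι_map i).proj_eq]
      · exact ((IsLinearMap.mk' _ ((h.pr_map j).linear x)).comp
          (IsLinearMap.mk' _ ((h.ι_map i).linear x))).isLinear

/-- A linear connection on `B` induces a unique connection on `B ⊕ B` compatible with the
projections. -/
theorem IsBundleSum.exists_connection (h : IsBundleSum F G H H' B B' pr ι)
    (hB : B.IsVectorBundle F G H) (hC : B.IsLinearConnection F G H C) :
    ∃ D : TangentBdl H' V' → TangentBdl H' V', B'.IsLinearConnection F (G × G) H' D ∧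
      (∀ i ξ, tangentMap H' H (pr i) (D ξ) = C (tangentMap H' H (pr i) ξ)) ∧
      ∀ i ξ, D (tangentMap H H' (ι i) ξ) = tangentMap H H' (ι i) (C ξ) := by
  choose D hpt hD using h.exists_tangent hB.1 hC.toIsConnection
  exact ⟨D, h.isLinearConnection hB hC hpt fun i ξ => hD ξ i, fun i ξ => hD ξ i,
    h.apply_tangentMap_ι hB hC hpt fun i ξ => hD ξ i⟩

end Sum

end VectorFibration

/-! ### Charts outside the atlas and shears -/

section SmoothCharts

variable {E : Type u} [AddCommGroup E] [Module ℝ E] [TopologicalSpace E]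
  [IsTopologicalAddGroup E] [ContinuousSMul ℝ E] [LocallyConvexSpace ℝ E] [T2Space E]
  {M : Type v} [TopologicalSpace M] [ChartedSpace E M] [SmoothManifold E M]
  {E' : Type u} [AddCommGroup E'] [Module ℝ E'] [TopologicalSpace E']
  [IsTopologicalAddGroup E'] [ContinuousSMul ℝ E'] [LocallyConvexSpace ℝ E'] [T2Space E']
  {N : Type w} [TopologicalSpace N] [ChartedSpace E' N] [SmoothManifold E' N]
  {G : Type u} [AddCommGroup G] [Module ℝ G] [TopologicalSpace G]
  [IsTopologicalAddGroup G] [ContinuousSMul ℝ G] [LocallyConvexSpace ℝ G] [T2Space G]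
  {G' : Type u} [AddCommGroup G'] [Module ℝ G'] [TopologicalSpace G']
  [IsTopologicalAddGroup G'] [ContinuousSMul ℝ G'] [LocallyConvexSpace ℝ G'] [T2Space G']

theorem MSmooth.of_smoothCharts {φ : M → N}
    (H : ∀ x : M, ∃ Φ : OpenPartialHomeomorph N G, IsSmoothChart (E := E') Φ ∧ ∃ W, IsOpen W ∧
      x ∈ W ∧ MapsTo φ W Φ.source ∧ SmoothFunOn E (fun x => Φ (φ x)) W) : MSmooth E E' φ := by
  refine MSmooth.of_charts fun x => ?_
  obtain ⟨Φ, hΦ, W, hW, hxW, hm, hf⟩ := H x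
  set c := chartAt E' (φ x)
  set U := (Φ.symm.trans c).source
  have hU : IsOpen U := (Φ.symm.trans c).open_source
  have ho : IsOpen (W ∩ (fun x => Φ (φ x)) ⁻¹' U) :=
    (hf.continuousOn hW).isOpen_inter_preimage hW hU
  have hU' {z : M} (hz : z ∈ W) (h : Φ (φ z) ∈ U) : φ z ∈ c.source := by
    have h1 : Φ.symm (Φ (φ z)) ∈ c.source := h.2
    rwa [Φ.left_inv (hm hz)] at h1
  refine ⟨c, chart_mem_atlas E' _, _, ho, ⟨hxW, Φ.map_source (hm hxW), ?_⟩,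
    fun z hz => hU' hz.1 hz.2, ?_⟩
  · change Φ.symm (Φ (φ x)) ∈ c.source
    rw [Φ.left_inv (hm hxW)]
    exact mem_chart_source E' _
  · exact ((hf.mono inter_subset_left).comp ho hU (hΦ.smooth_symm c (chart_mem_atlas E' _))
      fun z hz => hz.2).congr ho fun z hz => congrArg c (Φ.left_inv (hm hz.1))

theorem IsSmoothChart.trans' {Φ : OpenPartialHomeomorph M G} (hΦ : IsSmoothChart (E := E) Φ)
    {σ : OpenPartialHomeomorph G G'} (h : Φ.target = σ.source) (hσ : SmoothMB σ σ.source)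
    (hσ' : SmoothMB σ.symm σ.target) : IsSmoothChart (E := E) (Φ.trans' σ h) := by
  refine ⟨hΦ.smooth.comp Φ.open_source σ.open_source hσ fun x hx => h ▸ Φ.map_source hx,
    fun c hc => ?_⟩
  have ho := ((Φ.trans' σ h).symm.trans c).open_source
  have h1 : SmoothMB σ.symm ((Φ.trans' σ h).symm.trans c).source := hσ'.mono fun z hz => hz.1
  exact (hΦ.smooth_symm c hc).comp ho (Φ.symm.trans c).open_source h1
    fun z hz => ⟨by
      change σ.symm z ∈ Φ.target
      rw [h]
      exact σ.map_target hz.1, hz.2⟩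

theorem SmoothFunOn.sub {f g : M → G} {W : Set M} (hW : IsOpen W)
    (hf : SmoothFunOn E f W) (hg : SmoothFunOn E g W) : SmoothFunOn E (fun x => f x - g x) W :=
  fun e he => (hf e he).sub (isOpen_chart_preimage e hW) (hg e he)

/-- The shear `(y, v, w) ↦ (y, v, w - s (y, v))`. -/
noncomputable def shear (s : G × G' → E) {U : Set (G × G')} (hU : IsOpen U) (hs : SmoothMB s U) :
    OpenPartialHomeomorph (G × G' × E) (G × G' × E) where
  toFun z := (z.1, z.2.1, z.2.2 - s (z.1, z.2.1))
  invFun z := (z.1, z.2.1, z.2.2 + s (z.1, z.2.1))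
  source := {z | (z.1, z.2.1) ∈ U}
  target := {z | (z.1, z.2.1) ∈ U}
  map_source' _ hz := hz
  map_target' _ hz := hz
  left_inv' z _ := by simp
  right_inv' z _ := by simp
  open_source := hU.preimage (by fun_prop)
  open_target := hU.preimage (by fun_prop)
  continuousOn_toFun := by
    have hc : Continuous (fun z : G × G' × E => (z.1, z.2.1)) := by fun_prop
    have h := hs.continuousOn.comp (s := {z : G × G' × E | (z.1, z.2.1) ∈ U}) hc.continuousOn
      fun _ hz => hz
    exact continuousOn_fst.prodMk ((continuous_fst.comp continuous_snd).continuousOn.prodMk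
      ((continuous_snd.comp continuous_snd).continuousOn.sub h))
  continuousOn_invFun := by
    have hc : Continuous (fun z : G × G' × E => (z.1, z.2.1)) := by fun_prop
    have h := hs.continuousOn.comp (s := {z : G × G' × E | (z.1, z.2.1) ∈ U}) hc.continuousOn
      fun _ hz => hz
    exact continuousOn_fst.prodMk ((continuous_fst.comp continuous_snd).continuousOn.prodMk
      ((continuous_snd.comp continuous_snd).continuousOn.add h))

theorem shear_smooth {s : G × G' → E} {U : Set (G × G')} (hU : IsOpen U) (hs : SmoothMB s U) :
    SmoothMB (shear s hU hs) (shear s hU hs).source ∧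
      SmoothMB (shear s hU hs).symm (shear s hU hs).target := by
  have ho : IsOpen {z : G × G' × E | (z.1, z.2.1) ∈ U} := (shear s hU hs).open_source
  have h1 : SmoothMB (fun z : G × G' × E => z.1) {z | (z.1, z.2.1) ∈ U} := SmoothMB.fst
  have h2 : SmoothMB (fun z : G × G' × E => z.2.1) {z | (z.1, z.2.1) ∈ U} :=
    SmoothMB.clm ((ContinuousLinearMap.fst ℝ G' E).comp (ContinuousLinearMap.snd ℝ G (G' × E))) _
  have h3 : SmoothMB (fun z : G × G' × E => z.2.2) {z | (z.1, z.2.1) ∈ U} :=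
    SmoothMB.clm ((ContinuousLinearMap.snd ℝ G' E).comp (ContinuousLinearMap.snd ℝ G (G' × E))) _
  have h4 := hs.comp ho hU (h1.prodMk ho h2) fun _ hz => hz
  exact ⟨h1.prodMk ho (h2.prodMk ho (h3.sub ho h4)), h1.prodMk ho (h2.prodMk ho (h3.add ho h4))⟩

end SmoothCharts

section Spray

variable {F : Type u} [AddCommGroup F] [Module ℝ F] [TopologicalSpace F]
  [IsTopologicalAddGroup F] [ContinuousSMul ℝ F] [LocallyConvexSpace ℝ F] [T2Space F]
  {M : Type v} [TopologicalSpace M] [ChartedSpace F M] [SmoothManifold F M]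

/-! ### The tangent bundle as a vector bundle -/

theorem along_smul {e : OpenPartialHomeomorph M F} (he : e ∈ atlas F M) {p : TangentBdl F M}
    (hp : p.pt ∈ e.source) (s : ℝ) : along e (scale s p) = s • along e p :=
  (isLinearMap_along e.open_source (isSmoothChart_of_mem_atlas he).smooth hp).map_smul s p.vec

theorem isBundleChart_tangentHomeo (e : atlas F M) :
    (tangentVB F M).IsBundleChart F F (F × F) e.1 (tangentHomeo e) where
  mem_atlas := e.2
  source_eq := rfl
  target_eq := rfl
  fst_eq _ _ := rfl
  linear x hx := by
    have h := isLinearMap_along e.1.open_source (isSmoothChart_of_mem_atlas e.2).smooth hx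
    constructor
    · rintro ⟨⟨x, v⟩, rfl⟩ ⟨⟨y, w⟩, hy⟩
      obtain rfl : y = x := hy
      exact h.map_add v w
    · rintro a ⟨⟨x, v⟩, rfl⟩
      exact h.map_smul a v
  smooth := (isSmoothChart_tangentHomeo e).smooth
  smooth_symm := (isSmoothChart_tangentHomeo e).smooth_symm

variable (F M) in
theorem tangentVB_isVectorBundle : (tangentVB F M).IsVectorBundle F F (F × F) :=
  ⟨MSmooth.pt, fun x => ⟨_, tangentHomeo ⟨chartAt F x, chart_mem_atlas F x⟩, mem_chart_source F x,
    isBundleChart_tangentHomeo ⟨chartAt F x, chart_mem_atlas F x⟩⟩⟩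

theorem tangentVB_add_vec {x : M} (p q : (tangentVB F M).Fibre x) :
    (p + q).1.vec = p.1.vec + q.1.vec := rfl

theorem tangentVB_smul_vec {x : M} (a : ℝ) (p : (tangentVB F M).Fibre x) :
    (a • p).1.vec = a • p.1.vec := rfl

theorem tangentVB_fibre_ext {x : M} {p q : (tangentVB F M).Fibre x} (h : p.1.vec = q.1.vec) :
    p = q :=
  Subtype.ext (TangentBdl.ext (p.2.trans q.2.symm) h)

/-- The coordinates of a vertical vector of `TM`. -/
theorem along_vertical (e : atlas F M) {p : TangentBdl F M} (hp : p.pt ∈ e.1.source) (k : F) :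
    along (tangentHomeo e) (⟨p, (0, k)⟩ : DoubleTangent F M) =
      (0, along e.1 (⟨p.pt, k⟩ : TangentBdl F M)) := by
  set P : (tangentVB F M).Fibre p.pt := ⟨p, rfl⟩
  set K : (tangentVB F M).Fibre p.pt := ⟨⟨p.pt, k⟩, rfl⟩
  have h1 : (⟨p, (0, k)⟩ : DoubleTangent F M) = (tangentVB F M).verticalLift (F × F) P K := by
    refine TangentBdl.ext rfl ?_
    rw [← along_chartAt ((tangentVB F M).verticalLift (F × F) P K)]
    have h2 := (isBundleChart_tangentHomeo ⟨chartAt F p.pt, chart_mem_atlas F p.pt⟩)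
      |>.along_verticalLift (mem_chart_source F p.pt) P K
    refine Eq.trans ?_ h2.symm
    exact congrArg (Prod.mk (0 : F)) (along_chartAt (⟨p.pt, k⟩ : TangentBdl F M)).symm
  rw [h1]
  exact (isBundleChart_tangentHomeo e).along_verticalLift hp P K

/-! ### Sprays are quadratic -/

variable {S : TangentBdl F M → DoubleTangent F M}

theorem IsSpray.vec_fst (hS : IsSpray S) (p : TangentBdl F M) : (S p).vec.1 = p.vec := by
  have h := hS.second_order p
  rw [tangentProj_eq] at h
  exact congrArg TangentBdl.vec h

/-- In the chart of `TM` the map `L_s` is the continuous linear map `(x, v) ↦ (x, s v)`, so it is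
its own derivative. -/
theorem tangentMap_scale (s : ℝ) (ξ : DoubleTangent F M) :
    tangentMap (F × F) (F × F) (scale s : TangentBdl F M → TangentBdl F M) ξ =
      ⟨scale s ξ.pt, (ξ.vec.1, s • ξ.vec.2)⟩ := by
  refine TangentBdl.ext rfl ?_
  set c : atlas F M := ⟨chartAt F ξ.pt.pt, chart_mem_atlas F _⟩
  set L : F × F →L[ℝ] F × F :=
    (ContinuousLinearMap.fst ℝ F F).prod (s • ContinuousLinearMap.snd ℝ F F)
  change along (fun q => tangentHomeo c (scale s q)) ξ = L ξ.vec
  have h1 : L ξ.vec = L (along (tangentHomeo c) ξ) := congrArg L (along_chartAt ξ).symm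
  rw [h1, ← along_clm L (isSmoothChart_tangentHomeo c).smooth (mem_chart_source F ξ.pt.pt)]
  exact along_congr (tangentHomeo c).open_source
    (fun q hq => congrArg (Prod.mk (c.1 q.pt)) (along_smul c.2 hq s)) (mem_chart_source F ξ.pt.pt)

/-- One factor `s` comes from scaling the vector `S v`, the other from `TL_s`. -/
theorem IsSpray.vec_snd_smul (hS : IsSpray S) (x : M) (s : ℝ) (v : F) :
    (S ⟨x, s • v⟩).vec.2 = (s * s) • (S ⟨x, v⟩).vec.2 := by
  have h := hS.homogeneous s ⟨x, v⟩
  rw [tangentMap_scale] at h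
  rw [mul_smul]
  exact congrArg (fun ξ => ξ.vec.2) h

/-- Euler's argument for functions homogeneous of degree 2: along the ray through `v` the function
is `t² S₂(x, v)`, whose second derivative `2 S₂(x, v)` is cancelled by the factor `1/2` in `B`. -/
theorem IsSpray.sprayBilin_self (hS : IsSpray S) (x : M) (v : F) :
    sprayBilin S x v v = (S ⟨x, v⟩).vec.2 := by
  set f : F → F := fun b => (S ⟨x, b⟩).vec.2
  have hf (s : ℝ) : f (s • v) = (s * s) • f v := hS.vec_snd_smul x s v
  have h1 (t : ℝ) : dirDeriv f (t • v) v = (2 * t) • f v := by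
    refine HasDirDeriv.eq ?_
    have h2 : Tendsto (fun r : ℝ => (2 * t + r) • f v) (𝓝[≠] 0) (𝓝 ((2 * t) • f v)) := by
      have hc : Continuous (fun r : ℝ => (2 * t + r) • f v) := by fun_prop
      have := hc.tendsto 0
      rw [add_zero] at this
      exact this.mono_left nhdsWithin_le_nhds
    refine h2.congr' ?_
    filter_upwards [self_mem_nhdsWithin] with r hr
    have hr' : r ≠ 0 := hr
    rw [← add_smul, hf, hf, ← sub_smul, smul_smul]
    congr 1
    field_simp
    ring
  have h2 : HasDirDeriv (fun a => dirDeriv f a v) 0 v ((2 : ℝ) • f v) := by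
    refine tendsto_const_nhds.congr' ?_
    filter_upwards [self_mem_nhdsWithin] with t ht
    have ht' : t ≠ 0 := ht
    have h0 := h1 0
    simp only [zero_smul, mul_zero] at h0
    rw [zero_add, h1, h0, sub_zero, smul_smul]
    congr 1
    field_simp
  rw [sprayBilin, h2.eq, smul_smul]
  norm_num
  rfl

/-! ### The second-order tangent bundle as a vector bundle -/

/-- The principal part `S₂` of a spray in a chart. -/
noncomputable def sprayPart (S : TangentBdl F M → DoubleTangent F M) (e : atlas F M)
    (p : TangentBdl F M) : F :=
  (along (tangentHomeo e) (S p)).2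

theorem IsSpray.sprayPart_smooth (hS : IsSpray S) (e : atlas F M) :
    SmoothFunOn (F × F) (sprayPart S e) (tangentHomeo e).source := by
  have h1 := hS.smooth.smoothFunOn ((tangentHomeo e).open_source.preimage MSmooth.pt.1)
    ((isSmoothChart_tangentHomeo e).smooth.along (tangentHomeo e).open_source)
  have hm (p) (hp : p ∈ (tangentHomeo e).source) : (S p).pt ∈ (tangentHomeo e).source := by
    rwa [hS.pt_eq]
  exact (h1.mono hm).comp (tangentHomeo e).open_source isOpen_univ (SmoothMB.snd (E := F) (E' := F))
    (mapsTo_univ _ _)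

/-- On `T²M` the two middle entries coincide, so only the diagonal of `B` enters and `K` subtracts
the spray itself. -/
theorem secondPr_one (hS : IsSpray S) (ξ : SecondTangent F M) :
    secondPr S 1 ξ = ⟨ξ.1.pt.pt, ξ.1.vec.2 - (S ξ.1.pt).vec.2⟩ := by
  change connectionMap S ξ.1 = _
  rw [connectionMap, ξ.vec_fst, hS.sprayBilin_self]

/-- Covariance of the connection map on `T²M`. -/
theorem along_secondPr_one (hS : IsSpray S) (e : atlas F M) {ξ : SecondTangent F M}
    (hξ : ξ.1.pt.pt ∈ e.1.source) :
    along e.1 (secondPr S 1 ξ) =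
      (along (tangentHomeo e) ξ.1).2 - sprayPart S e ξ.1.pt := by
  have h := isLinearMap_along (tangentHomeo e).open_source (isSmoothChart_tangentHomeo e).smooth
    (show ξ.1.pt ∈ (tangentHomeo e).source from hξ)
  have h1 : (⟨ξ.1.pt, (S ξ.1.pt).vec⟩ : DoubleTangent F M) = S ξ.1.pt :=
    TangentBdl.ext (hS.pt_eq _).symm rfl
  -- Both vectors are of second order at the same point of `TM`, so their difference is vertical;
  -- its coordinates transform like those of a vector of `TM`, with no second-derivative term.
  have h2 : ξ.1.vec - (S ξ.1.pt).vec = (0, ξ.1.vec.2 - (S ξ.1.pt).vec.2) :=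
    Prod.ext (by
      change ξ.1.vec.1 - (S ξ.1.pt).vec.1 = 0
      rw [hS.vec_fst, ξ.vec_fst, sub_self]) rfl
  have h3 := h.map_sub ξ.1.vec (S ξ.1.pt).vec
  simp only [h1, h2, along_vertical e hξ] at h3
  rw [secondPr_one hS]
  exact congrArg Prod.snd h3

theorem isSmoothChart_secondHomeo (e : atlas F M) :
    IsSmoothChart (E := F × F × F) (secondHomeo e) :=
  isSmoothChart_of_mem_atlas (mem_range_self e)

/-- In natural charts the two projections are `(x, v, w) ↦ (x, v)` and `(x, v, w) ↦ (x, w - S₂(x,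
v))`. -/
theorem secondPr_smooth (hS : IsSpray S) (i : Fin 2) :
    MSmooth (F × F × F) (F × F) (secondPr S i) := by
  have ha (e : atlas F M) : SmoothFunOn (F × F × F) (fun ξ : SecondTangent F M => e.1 ξ.1.pt.pt)
      (secondHomeo e).source :=
    (isSmoothChart_secondHomeo e).smooth.comp (secondHomeo e).open_source isOpen_univ
      (SmoothMB.fst (E := F) (E' := F × F)) (mapsTo_univ _ _)
  have h0 : MSmooth (F × F × F) (F × F) (fun ξ : SecondTangent F M => ξ.1.pt) := by
    refine MSmooth.of_charts fun ξ => ?_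
    set e : atlas F M := ⟨chartAt F ξ.1.pt.pt, chart_mem_atlas F _⟩
    have h : SmoothMB (fun z : F × F × F => z.2.1) univ :=
      SmoothMB.clm ((ContinuousLinearMap.fst ℝ F F).comp (ContinuousLinearMap.snd ℝ F (F × F))) _
    refine ⟨tangentHomeo e, mem_atlas_tangent.2 ⟨e, rfl⟩, _, (secondHomeo e).open_source,
      mem_chart_source F ξ.1.pt.pt, fun _ h => h, ?_⟩
    have h2 : SmoothFunOn (F × F × F) (fun ξ : SecondTangent F M => along e.1 ξ.1.pt)
        (secondHomeo e).source := by
      have := (isSmoothChart_secondHomeo e).smooth.comp (secondHomeo e).open_source isOpen_univ h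
        (mapsTo_univ _ _)
      exact this
    exact (ha e).prodMk (secondHomeo e).open_source h2
  have h1 : MSmooth (F × F × F) (F × F) (secondPr S 1) := by
    refine MSmooth.of_charts fun ξ => ?_
    set e : atlas F M := ⟨chartAt F ξ.1.pt.pt, chart_mem_atlas F _⟩
    have ho := (secondHomeo e).open_source
    refine ⟨tangentHomeo e, mem_atlas_tangent.2 ⟨e, rfl⟩, _, ho,
      mem_chart_source F ξ.1.pt.pt, fun _ h => h, ?_⟩
    have h : SmoothMB (fun z : F × F × F => z.2.2) univ :=
      SmoothMB.clm ((ContinuousLinearMap.snd ℝ F F).comp (ContinuousLinearMap.snd ℝ F (F × F))) _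
    have h2 : SmoothFunOn (F × F × F)
        (fun ξ : SecondTangent F M => (along (tangentHomeo e) ξ.1).2) (secondHomeo e).source := by
      have := (isSmoothChart_secondHomeo e).smooth.comp ho isOpen_univ h (mapsTo_univ _ _)
      exact this
    have h3 := h0.smoothFunOn (tangentHomeo e).open_source (hS.sprayPart_smooth e)
    exact ((ha e).prodMk ho (h2.sub ho h3)).congr ho
      fun ξ hξ => congrArg (Prod.mk (e.1 ξ.1.pt.pt)) (along_secondPr_one hS e hξ).symm
  fin_cases i
  exacts [h0, h1]

theorem secondPr_pt (i : Fin 2) (ξ : SecondTangent F M) : (secondPr S i ξ).pt = ξ.1.pt.pt := by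
  fin_cases i <;> rfl

theorem secondFibreEquiv_isLinearMap (x : M) :
    IsLinearMap ℝ (fun ξ : (secondVB S).Fibre x => secondFibreEquiv S x ξ) :=
  ⟨fun _ _ => (secondFibreEquiv S x).apply_symm_apply _,
    fun _ _ => (secondFibreEquiv S x).apply_symm_apply _⟩

theorem secondPr_isBundleMap (hS : IsSpray S) (i : Fin 2) :
    VectorFibration.IsBundleMap (F × F × F) (F × F) (secondVB S) (tangentVB F M)
      (secondPr S i) := by
  have h (x : M) := secondFibreEquiv_isLinearMap (S := S) x
  refine ⟨secondPr_smooth hS i, secondPr_pt i, fun x => ⟨fun p q => tangentVB_fibre_ext ?_,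
    fun a p => tangentVB_fibre_ext ?_⟩⟩
  · rw [tangentVB_add_vec]
    fin_cases i
    exacts [congrArg Prod.fst ((h x).map_add p q), congrArg Prod.snd ((h x).map_add p q)]
  · rw [tangentVB_smul_vec]
    fin_cases i
    exacts [congrArg Prod.fst ((h x).map_smul a p), congrArg Prod.snd ((h x).map_smul a p)]

/-- The bundle chart of `T²M` induced by a spray and a chart of `M`. -/
theorem exists_isBundleChart_second (hS : IsSpray S) (e : atlas F M) :
    ∃ Φ : OpenPartialHomeomorph (SecondTangent F M) (F × (F × F)),
      (secondVB S).IsBundleChart F (F × F) (F × F × F) e.1 Φ ∧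
      ∀ ξ, (secondVB S).proj ξ ∈ e.1.source →
        (Φ ξ).2 = ((tangentHomeo e (secondPr S 0 ξ)).2, (tangentHomeo e (secondPr S 1 ξ)).2) := by
  set s : F × F → F := fun z => sprayPart S e ((tangentHomeo e).symm z)
  have hs : SmoothMB s (e.1.target ×ˢ univ) := by
    refine SmoothMB.mono ?_ (hS.sprayPart_smooth e _ (mem_atlas_tangent.2 ⟨e, rfl⟩))
    exact fun z hz => ⟨hz, e.1.map_target hz.1⟩
  -- The natural chart of `T²M` is corrected by subtracting `S₂(x, v)` from the last entry; the
  -- fibre coordinates become those of `Π` and `K`, hence linear.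
  set σ := shear s (e.1.open_target.prod isOpen_univ) hs
  have hσ := shear_smooth (e.1.open_target.prod isOpen_univ) hs
  have hst : (secondHomeo e).target = σ.source := by
    ext z
    exact ⟨fun h => ⟨h.1, mem_univ _⟩, fun h => ⟨h.1, mem_univ _⟩⟩
  set Φ := (secondHomeo e).trans' σ hst
  have hΦ : IsSmoothChart (E := F × F × F) Φ :=
    (isSmoothChart_secondHomeo e).trans' hst hσ.1 hσ.2
  have key (ξ : SecondTangent F M) (hξ : ξ.1.pt.pt ∈ e.1.source) :
      (Φ ξ).2 = ((tangentHomeo e (secondPr S 0 ξ)).2, (tangentHomeo e (secondPr S 1 ξ)).2) := by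
    refine Prod.ext rfl ?_
    refine Eq.trans ?_ (along_secondPr_one hS e hξ).symm
    change _ - sprayPart S e ((tangentHomeo e).symm (tangentHomeo e ξ.1.pt)) = _
    rw [(tangentHomeo e).left_inv hξ]
    rfl
  refine ⟨Φ, ⟨e.2, rfl, ?_, fun _ _ => rfl, fun x hx => ?_, hΦ.smooth, hΦ.smooth_symm⟩, key⟩
  · ext z
    exact ⟨fun h => ⟨h.1, mem_univ _⟩, fun h => ⟨h.1, mem_univ _⟩⟩
  · have h0 (i : Fin 2) := ((IsLinearMap.mk' _ ((isBundleChart_tangentHomeo e).linear x hx)).comp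
      (IsLinearMap.mk' _ ((secondPr_isBundleMap hS i).linear x))).isLinear
    have h1 : (fun p : (secondVB S).Fibre x => (Φ p.1).2) = fun p =>
        ((tangentHomeo e (secondPr S 0 p.1)).2, (tangentHomeo e (secondPr S 1 p.1)).2) :=
      funext fun p => key p.1 (by rw [show p.1.1.pt.pt = x from p.2]; exact hx)
    rw [h1]
    exact ⟨fun p q => Prod.ext ((h0 0).map_add p q) ((h0 1).map_add p q),
      fun a p => Prod.ext ((h0 0).map_smul a p) ((h0 1).map_smul a p)⟩

theorem secondIncl_proj (i : Fin 2) (p : TangentBdl F M) :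
    (secondIncl S i p).1.pt.pt = p.pt :=
  ((secondFibreEquiv S p.pt).symm (if i = 0 then (p.vec, 0) else (0, p.vec))).2

theorem secondPr_secondIncl_vec (i j : Fin 2) (p : TangentBdl F M) :
    (secondPr S j (secondIncl S i p)).vec = if i = j then p.vec else 0 := by
  have h := (secondFibreEquiv S p.pt).apply_symm_apply (if i = 0 then (p.vec, 0) else (0, p.vec))
  fin_cases j
  · refine (congrArg Prod.fst h).trans ?_
    fin_cases i <;> simp
  · refine (congrArg Prod.snd h).trans ?_
    fin_cases i <;> simp

theorem secondPr_secondIncl (i : Fin 2) (p : TangentBdl F M) :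
    secondPr S i (secondIncl S i p) = p :=
  TangentBdl.ext ((secondPr_pt i _).trans (secondIncl_proj i p))
    ((secondPr_secondIncl_vec i i p).trans (if_pos rfl))

theorem secondPr_secondIncl_of_ne {i j : Fin 2} (h : i ≠ j) (p : TangentBdl F M) :
    secondPr S j (secondIncl S i p) = ⟨p.pt, 0⟩ :=
  TangentBdl.ext ((secondPr_pt j _).trans (secondIncl_proj i p))
    ((secondPr_secondIncl_vec i j p).trans (if_neg h))

theorem second_fibre_ext {x : M} {ξ η : (secondVB S).Fibre x}
    (h : ∀ i, (secondPr S i ξ.1).vec = (secondPr S i η.1).vec) : ξ = η :=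
  (secondFibreEquiv S x).injective (Prod.ext (h 0) (h 1))

/-- The inclusion is defined through the preferred chart at each point, which varies. In a bundle
chart adapted to the sum its components are those of `pr_j ∘ ι_i`, that is, of the identity or of
zero. -/
theorem secondIncl_smooth (hS : IsSpray S) (i : Fin 2) :
    MSmooth (F × F) (F × F × F) (secondIncl S i) := by
  refine MSmooth.of_smoothCharts (G := F × (F × F)) fun p => ?_
  set e : atlas F M := ⟨chartAt F p.pt, chart_mem_atlas F _⟩
  obtain ⟨Φ, hΦ, hΦ'⟩ := exists_isBundleChart_second hS e
  have ho := (tangentHomeo e).open_source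
  have hm {q : TangentBdl F M} (hq : q.pt ∈ e.1.source) :
      (secondVB S).proj (secondIncl S i q) ∈ e.1.source := by
    change (secondIncl S i q).1.pt.pt ∈ _
    rwa [secondIncl_proj]
  refine ⟨Φ, hΦ.isSmoothChart, _, ho, mem_chart_source F p.pt,
    fun q hq => hΦ.mem_source.2 (hm hq), ?_⟩
  have hfst : SmoothFunOn (F × F) (fun q : TangentBdl F M => e.1 q.pt) (tangentHomeo e).source :=
    (isSmoothChart_tangentHomeo e).smooth.comp ho isOpen_univ (SmoothMB.fst (E := F) (E' := F))
      (mapsTo_univ _ _)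
  have hsnd : SmoothFunOn (F × F) (fun q : TangentBdl F M => (tangentHomeo e q).2)
      (tangentHomeo e).source :=
    (isSmoothChart_tangentHomeo e).smooth.comp ho isOpen_univ (SmoothMB.snd (E := F) (E' := F))
      (mapsTo_univ _ _)
  have hj (j : Fin 2) : SmoothFunOn (F × F)
      (fun q : TangentBdl F M => (tangentHomeo e (secondPr S j (secondIncl S i q))).2)
      (tangentHomeo e).source := by
    rcases eq_or_ne i j with rfl | hij
    · simp only [secondPr_secondIncl]
      exact hsnd
    · have h0 : SmoothFunOn (F × F) (fun _ : TangentBdl F M => (0 : F)) (tangentHomeo e).source :=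
        fun _ _ => SmoothMB.zero
      refine h0.congr ho fun q hq => ?_
      rw [secondPr_secondIncl_of_ne hij]
      exact (VectorFibration.along_eq_zero (ξ := ⟨q.pt, 0⟩) e.2 hq rfl rfl).symm
  refine (hfst.prodMk ho ((hj 0).prodMk ho (hj 1))).congr ho fun q hq => ?_
  have h1 : (secondVB S).proj (secondIncl S i q) = q.pt := secondIncl_proj (S := S) i q
  refine Eq.trans ?_ (hΦ.apply_eq (hm hq)).symm
  rw [hΦ' _ (hm hq), h1]

/-- Fibrewise linearity is checked after `pr_0` and `pr_1`, which together are injective on each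
fibre. -/
theorem secondIncl_isBundleMap (hS : IsSpray S) (i : Fin 2) :
    VectorFibration.IsBundleMap (F × F) (F × F × F) (tangentVB F M) (secondVB S)
      (secondIncl S i) := by
  have hpr (j : Fin 2) (x : M) := (secondPr_isBundleMap hS j).linear x
  refine ⟨secondIncl_smooth hS i, secondIncl_proj (S := S) i,
    fun x => ⟨fun p q => ?_, fun a p => ?_⟩⟩ <;>
    refine second_fibre_ext fun j => ?_
  · refine Eq.trans ?_ (congrArg (fun r => r.1.vec) ((hpr j x).map_add _ _)).symm
    rw [tangentVB_add_vec]
    simp only [secondPr_secondIncl_vec]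
    split_ifs
    · rfl
    · simp
  · refine Eq.trans ?_ (congrArg (fun r => r.1.vec) ((hpr j x).map_smul _ _)).symm
    rw [tangentVB_smul_vec]
    simp only [secondPr_secondIncl_vec]
    split_ifs
    · rfl
    · simp

/-- `T²M ≅ TM ⊕ TM` by means of a spray. -/
theorem second_isBundleSum (hS : IsSpray S) :
    VectorFibration.IsBundleSum F F (F × F) (F × F × F) (tangentVB F M) (secondVB S)
      (secondPr S) (secondIncl S) where
  pr_map := secondPr_isBundleMap hS
  ι_map := secondIncl_isBundleMap hS
  pr_ι := secondPr_secondIncl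
  pr_ι_ne _ _ h p := secondPr_secondIncl_of_ne h p
  charts x := by
    obtain ⟨Φ, hΦ, hΦ'⟩ := exists_isBundleChart_second hS ⟨chartAt F x, chart_mem_atlas F x⟩
    exact ⟨_, _, Φ, mem_chart_source F x,
      isBundleChart_tangentHomeo ⟨chartAt F x, chart_mem_atlas F x⟩, hΦ, hΦ'⟩

end Spray

end FrechetGeometry

/-! ### The theorem -/

open FrechetGeometry in
theorem mainTheorem4
    {F : Type u} [AddCommGroup F] [Module ℝ F] [UniformSpace F] [IsUniformAddGroup F]
    [ContinuousSMul ℝ F] [LocallyConvexSpace ℝ F] [T2Space F] [CompleteSpace F]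
    [(uniformity F).IsCountablyGenerated]
    {M : Type v} [TopologicalSpace M] [ChartedSpace F M] [SmoothManifold F M]
    (S : TangentBdl F M → DoubleTangent F M) (hS : IsSpray S) :
    (secondVB S).IsVectorBundle F (F × F) (F × F × F) ∧
    (∀ C : DoubleTangent F M → DoubleTangent F M,
      (tangentVB F M).IsLinearConnection F F (F × F) C → IsSymmetricTM C →
      ∃! D : TangentBdl (F × F × F) (SecondTangent F M) →
          TangentBdl (F × F × F) (SecondTangent F M),
        (secondVB S).IsLinearConnection F (F × F) (F × F × F) D ∧
        IsSymmetricSecond S D ∧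
        ∀ i ξ, tangentMap (F × F × F) (F × F) (secondPr S i) (D ξ) =
          C (tangentMap (F × F × F) (F × F) (secondPr S i) ξ)) ∧
    (∀ D : TangentBdl (F × F × F) (SecondTangent F M) →
          TangentBdl (F × F × F) (SecondTangent F M),
      (secondVB S).IsLinearConnection F (F × F) (F × F × F) D →
      ∀ i, (tangentVB F M).IsLinearConnection F F (F × F)
          (fun ξ => tangentMap (F × F × F) (F × F) (secondPr S i)
            (D (tangentMap (F × F) (F × F × F) (secondIncl S i) ξ))) ∧
        (IsSymmetricSecond S D →
          IsSymmetricTM (fun ξ => tangentMap (F × F × F) (F × F) (secondPr S i)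
            (D (tangentMap (F × F) (F × F × F) (secondIncl S i) ξ))))) := by
  have hT := tangentVB_isVectorBundle F M
  have hsum := second_isBundleSum hS
  have hT₂ := hsum.isVectorBundle hT.1
  refine ⟨hT₂, fun C hC hsymm => ?_, fun D hD i => ⟨?_, fun hsymm ξ => ?_⟩⟩
  · obtain ⟨D, hD, hpr, hι⟩ := hsum.exists_connection hT hC
    refine ⟨D, ⟨hD, fun i ξ => ?_, hpr⟩, fun D' hD' => funext fun ξ => ?_⟩
    -- After rewriting `D ∘ Tι_i` as `Tι_i ∘ C`, symmetry of `D` is the image of symmetry of `C`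
    -- under `Tι_i`.
    · rw [hι, hι]
      exact (hsum.ι_map i).sameVerticalPart hT hT₂ (hsymm ξ)
    -- Uniqueness uses only the base points and the two projections of the values; symmetry of the
    -- competitor plays no part.
    · refine hsum.ext_tangent hT.1 hT₂.1 ?_ fun i => ?_
      · rw [hD.pt_eq, hD'.1.pt_eq]
      · rw [hpr, hD'.2.2]
  · exact VectorFibration.IsLinearConnection.summand (hsum.ι_map i) (hsum.pr_map i) (hsum.pr_ι i)
      hT hT₂ hD
  · exact (hsum.pr_map i).sameVerticalPart hT₂ hT (hsymm i ξ)
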